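/- For $\omega\in[0,\pi]$ let $\Omega=\Omega_\omega\subset\mathbb R^2$ be the open square $(-1,1)^2$ rotated counterclockwise about the origin by the angle $\omega$. For $\epsilon>0$ let $$a(u,v)=\int_\Omega(\partial_xu\,\partial_xv+\epsilon\,\partial_yu\,\partial_yv)\,dx\,dy,\qquad \|v\|_a^2=a(v,v),$$ be the energy form of the problem $-u_{xx}-\epsilon u_{yy}=f$ in $\Omega$, $u=0$ on $\partial\Omega$. For an integer $N\ge1$ divide $(-1,1)^2$ into $N\times N$ equal squares, cut each of them into two triangles by its diagonal of direction $(1,1)$, and rotate by $\omega$; this gives the coarse triangulation $\mathcal T_H$. The fine triangulation $\mathcal T_h$ is obtained by splitting each triangle of $\mathcal T_H$ into four congruent triangles (so it is the uniform $2N\times2N$ triangulation). Let $V_H\subset V_h\subset H^1_0(\Omega)$ be the corresponding spaces of continuous piecewise linear functions vanishing on $\partial\Omega$. Let $h$ be the mesh size of $\mathcal T_h$, measured either as the side length $1/N$ of the fine squares or as the diameter $\sqrt2/N$ of the fine triangles (the result holds with both conventions). Let $y_{\max}$ and $y_{\min}$ be the maximum and the minimum of $y$ over $\overline\Omega$, and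 $L=\lfloor (y_{\max}-y_{\min})/h\rfloor$. For $1\le i\le L$ let $\Omega_i$ be the union of all triangles of $\mathcal T_h$ that have a vertex in the strip $(i-1)h\le y-y_{\min}\le(i+1)h$, and let $V_i=\{v\in V_h:\operatorname{supp}v\subseteq\overline{\Omega}_i\}$. Let $P_i$ and $P_H$ be the $a$-orthogonal projections of $V_h$ onto $V_i$ and $V_H$. The two-level method with coarse space $V_H$ and line (block) Gauss--Seidel smoother with blocks $V_1,\dots,V_L$ has the error propagation operator $$E_{TL}=(I-T)(I-P_H),\qquad I-T=(I-P_L)(I-P_{L-1})\cdots(I-P_1),$$ with the norm $\|E_{TL}\|_a=\sup_{0\ne v\in V_h}\|E_{TL}v\|_a/\|v\|_a$. **Theorem.** For every $\epsilon_0>0$ there is a constant $C\ge1$, depending only on $\epsilon_0$, such that for all $\omega\in[0,\pi]$, all $0<\epsilon\le\epsilon_0$ and all $N\ge1$ $$\|E_{TL}\|_a^2\le 1-\frac1C .$$ In particular $C$ is independent of $\epsilon$ and $h$. -/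

import Mathlib

open Set MeasureTheory
open scoped ENNReal

namespace AnisoFEM

noncomputable section

/-- Counterclockwise rotation of the plane by the angle `ω` around the origin. -/
def rotate (ω : ℝ) (p : ℝ × ℝ) : ℝ × ℝ :=
  (Real.cos ω * p.1 - Real.sin ω * p.2, Real.sin ω * p.1 + Real.cos ω * p.2)

/-- The computational domain: the open square `(-1,1)²` rotated by the angle `ω`. -/
def domain (ω : ℝ) : Set (ℝ × ℝ) :=
  rotate ω '' (Ioo (-1 : ℝ) 1 ×ˢ Ioo (-1 : ℝ) 1)

/-- The node `(i, j)`, `0 ≤ i, j ≤ M`, of the rotated uniform `M × M` grid. -/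
def node (ω : ℝ) (M i j : ℕ) : ℝ × ℝ :=
  rotate ω (-1 + 2 * (i : ℝ) / M, -1 + 2 * (j : ℝ) / M)

/-- The uniform triangulation of the rotated square: each of the `M × M` grid squares is cut into
two triangles by its diagonal of direction `(1,1)` (before the rotation).  A triangle is
represented by the set of its three vertices; as a point set it is the convex hull of that set.
The triangulation with `2 * M` in place of `M` arises from this one by splitting every triangle
into four congruent ones. -/
def mesh (ω : ℝ) (M : ℕ) : Set (Set (ℝ × ℝ)) :=
  {S | ∃ i < M, ∃ j < M,
    S = {node ω M i j, node ω M (i + 1) j, node ω M (i + 1) (j + 1)} ∨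
    S = {node ω M i j, node ω M i (j + 1), node ω M (i + 1) (j + 1)}}

/-- The conforming linear finite element space in `H¹₀` on the uniform `M × M` triangulation:
continuous functions which are affine on every (closed) triangle and vanish on the boundary of the
domain; they are extended by zero to the whole plane. -/
def femSpace (ω : ℝ) (M : ℕ) : Submodule ℝ (ℝ × ℝ → ℝ) where
  carrier := {u | Continuous u ∧ (∀ p, p ∉ domain ω → u p = 0) ∧
    ∀ S ∈ mesh ω M, ∃ a b c : ℝ, ∀ p ∈ convexHull ℝ S, u p = a * p.1 + b * p.2 + c}
  zero_mem' := ⟨continuous_zero, fun _ _ => rfl, fun _ _ => ⟨0, 0, 0, fun _ _ => by simp⟩⟩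
  add_mem' := by
    rintro u v ⟨hu, hu0, hu1⟩ ⟨hv, hv0, hv1⟩
    refine ⟨hu.add hv, fun p hp => by simp [hu0 p hp, hv0 p hp], fun S hS => ?_⟩
    obtain ⟨a, b, c, h⟩ := hu1 S hS
    obtain ⟨a', b', c', h'⟩ := hv1 S hS
    refine ⟨a + a', b + b', c + c', fun p hp => ?_⟩
    rw [Pi.add_apply, h p hp, h' p hp]
    ring
  smul_mem' := by
    rintro t u ⟨hu, hu0, hu1⟩
    refine ⟨hu.const_smul t, fun p hp => by simp [hu0 p hp], fun S hS => ?_⟩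
    obtain ⟨a, b, c, h⟩ := hu1 S hS
    refine ⟨t * a, t * b, t * c, fun p hp => ?_⟩
    rw [Pi.smul_apply, h p hp, smul_eq_mul]
    ring

/-- The energy form `a(u,v) = ∫_Ω (∂ₓu ∂ₓv + ε ∂_yu ∂_yv)`.  For finite element functions the
classical derivatives exist off the edges of the triangulation and agree with the weak ones. -/
def energyForm (ω ε : ℝ) (u v : ℝ × ℝ → ℝ) : ℝ :=
  ∫ p in domain ω,
    (fderiv ℝ u p (1, 0) * fderiv ℝ v p (1, 0)
      + ε * (fderiv ℝ u p (0, 1) * fderiv ℝ v p (0, 1)))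

/-- The energy norm `‖u‖_a = a(u,u)^{1/2}`. -/
def energyNorm (ω ε : ℝ) (u : ℝ × ℝ → ℝ) : ℝ :=
  Real.sqrt (energyForm ω ε u u)

open Classical in
/-- The orthogonal projection of `v` onto `W` with respect to the energy form: the element `w` of
`W` with `a(v - w, z) = 0` for all `z ∈ W`.  For `v` in a finite element space and `W` a subspace
of it, `w` exists and is unique, the form being positive definite on finite element functions. -/
def energyProj (ω ε : ℝ) (W : Submodule ℝ (ℝ × ℝ → ℝ)) (v : ℝ × ℝ → ℝ) : ℝ × ℝ → ℝ :=
  if h : ∃ w ∈ W, ∀ z ∈ W, energyForm ω ε (v - w) z = 0 then h.choose else 0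

/-- The smallest ordinate of the domain. -/
def yMin (ω : ℝ) : ℝ := sInf (Prod.snd '' closure (domain ω))

/-- The largest ordinate of the domain. -/
def yMax (ω : ℝ) : ℝ := sSup (Prod.snd '' closure (domain ω))

/-- The number of strips `L = [(y_max - y_min) / h]`. -/
def numStrips (ω h : ℝ) : ℕ := ⌊(yMax ω - yMin ω) / h⌋₊

/-- The `i`-th strip `(i-1)h ≤ y - y_min ≤ (i+1)h`, for `1 ≤ i ≤ L`. -/
def strip (ω h : ℝ) (i : ℕ) : Set (ℝ × ℝ) :=
  {p | ((i : ℝ) - 1) * h ≤ p.2 - yMin ω ∧ p.2 - yMin ω ≤ ((i : ℝ) + 1) * h}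

/-- The union `Ω_i` of the triangles that have a node in the `i`-th strip. -/
def stripRegion (ω : ℝ) (M : ℕ) (h : ℝ) (i : ℕ) : Set (ℝ × ℝ) :=
  ⋃ S ∈ {S ∈ mesh ω M | (S ∩ strip ω h i).Nonempty}, convexHull ℝ S

/-- The block `V_i`: the finite element functions supported in the closure of `Ω_i`. -/
def stripSpace (ω : ℝ) (M : ℕ) (h : ℝ) (i : ℕ) : Submodule ℝ (ℝ × ℝ → ℝ) where
  carrier := {v | v ∈ femSpace ω M ∧ tsupport v ⊆ closure (stripRegion ω M h i)}
  zero_mem' := ⟨zero_mem _, by simp [tsupport]⟩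
  add_mem' := by
    rintro u v ⟨hu, hu'⟩ ⟨hv, hv'⟩
    exact ⟨add_mem hu hv, (tsupport_add u v).trans (union_subset hu' hv')⟩
  smul_mem' := by
    rintro t u ⟨hu, hu'⟩
    exact ⟨Submodule.smul_mem _ t hu,
      (closure_mono (Function.support_const_smul_subset t u)).trans hu'⟩

/-- Error propagation of the first `n` steps of one block Gauss-Seidel sweep with exact block
solves, `(I - P_n) ⋯ (I - P_1)`, where `P_i` is the energy projection onto the block `V_i`. -/
def blockSweep (ω ε : ℝ) (M : ℕ) (h : ℝ) : ℕ → (ℝ × ℝ → ℝ) → (ℝ × ℝ → ℝ)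
  | 0, v => v
  | n + 1, v =>
    blockSweep ω ε M h n v
      - energyProj ω ε (stripSpace ω M h (n + 1)) (blockSweep ω ε M h n v)

/-- The two-level error propagation operator `E_TL = (I - T)(I - P_H)`, where `V_H` belongs to the
`N × N` grid, `V_h` to the `2N × 2N` grid, `P_H` is the energy projection onto `V_H`, and
`I - T = (I - P_L) ⋯ (I - P_1)` is the error propagation of the block Gauss-Seidel smoother. -/
def twoLevelError (ω ε : ℝ) (N : ℕ) (h : ℝ) (v : ℝ × ℝ → ℝ) : ℝ × ℝ → ℝ :=
  blockSweep ω ε (2 * N) h (numStrips ω h) (v - energyProj ω ε (femSpace ω N) v)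

/-- The operator norm on `V` induced by the energy norm: `sup_{v ∈ V} ‖E v‖_a / ‖v‖_a`, with values
in `[0, ∞]`. -/
def energyOpNorm (ω ε : ℝ) (V : Submodule ℝ (ℝ × ℝ → ℝ))
    (E : (ℝ × ℝ → ℝ) → (ℝ × ℝ → ℝ)) : ℝ≥0∞ :=
  ⨆ v ∈ V, ENNReal.ofReal (energyNorm ω ε (E v)) / ENNReal.ofReal (energyNorm ω ε v)

end

end AnisoFEM

/-!
The energy norm of the two-level error operator is bounded away from `1` because every fine
function has a decomposition `v = v_H + ∑ v_i` into a coarse function and functions of the line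
blocks with `∑ ‖v_i‖² ≤ C ‖v‖²`, where `C` depends on `ε₀` only (`exists_stable_decomposition`).
Given such a decomposition, the usual analysis of successive subspace correction applies: the
squared norms of the corrections add up to `‖v‖² - ‖E v‖²`, blocks of distant strips are orthogonal,
and so the corrections control `‖v‖` (`sweep_contraction`).

On finite element functions the energy form is a sum over congruent triangles of products of slopes,
which are differences of nodal values (`energyForm_eq_sum`).  Everything that follows is therefore
a statement about grid functions.  In particular the energy form is the pullback of a Euclidean inner
product (`exists_gradientMap`), which provides the projections; definiteness is not needed.

For the decomposition, `v_H` is the nodal interpolant of `v`, and the nodal values of `v_i` are those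
of `w = v - v_H` times a hat function `θ_i` of the height `y`.  The difficulty is that the
`x`-derivative of the interpolant of `θ_i w` contains terms `w ∂ₓ θ_i` on the discrete level, since
the nodes of a triangle differ in height.  They have no factor `ε`, and `w` is not bounded by the
`x`-derivative of `v`, as the aligned grid shows.  Let `s`, `c`, `c + s` be the height differences
along the three directions of edges (`s = sin ω`, `c = cos ω`).  Taking each vertex of a triangle in
turn as the base point, one finds that only the products `c s (c + s) w` have to be estimated
(`slopeX_cutoff_le`); this uses `s² + c² + (c + s)² ≥ 1`.  On the other hand
`w` vanishes at the coarse nodes and is a second difference of `v` at the edge midpoints, hence a sum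
of two jumps of directional derivatives across edges, and the jump of the `x`-slope across an edge is
the second difference across it times the height difference along it.  So `c s (c + s) w` is bounded
by the `x`-slopes of `v` on the same coarse square (`IsInterpolationError.sq_le_patchX`), with a
constant that depends neither on `ω` nor on the grid.  The `y`-slopes carry the factor `ε ≤ ε₀` and
are estimated by an inverse inequality.  All estimates are local to the squares of the coarse grid,
and each square meets boundedly many strips (`sum_patch_stripHat_le`).
-/

open Set MeasureTheory
open scoped ENNReal

namespace AnisoFEM

section

variable {ω : ℝ} {M N : ℕ}

/-! ### Grid coordinates -/

/-- First coordinate of a point in the rotated grid, in units of the grid size: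
the node `(i, j)` has first grid coordinate `i`. -/
noncomputable def gridX (ω : ℝ) (M : ℕ) (p : ℝ × ℝ) : ℝ :=
  M / 2 * (Real.cos ω * p.1 + Real.sin ω * p.2 + 1)

/-- Second coordinate of a point in the rotated grid, in units of the grid size:
the node `(i, j)` has second grid coordinate `j`. -/
noncomputable def gridY (ω : ℝ) (M : ℕ) (p : ℝ × ℝ) : ℝ :=
  M / 2 * (-Real.sin ω * p.1 + Real.cos ω * p.2 + 1)

lemma continuous_gridX : Continuous (gridX ω M) := by unfold gridX; fun_prop

lemma continuous_gridY : Continuous (gridY ω M) := by unfold gridY; fun_prop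

lemma gridX_rotate (x y : ℝ) :
    gridX ω M (rotate ω (x, y)) = M / 2 * (x + 1) := by
  have h := Real.sin_sq_add_cos_sq ω
  simp only [gridX, rotate]
  linear_combination (M / 2 * x : ℝ) * h

lemma gridY_rotate (x y : ℝ) :
    gridY ω M (rotate ω (x, y)) = M / 2 * (y + 1) := by
  have h := Real.sin_sq_add_cos_sq ω
  simp only [gridY, rotate]
  linear_combination (M / 2 * y : ℝ) * h

lemma gridX_node (hM : 1 ≤ M) (i j : ℕ) : gridX ω M (node ω M i j) = i := by
  have : (M : ℝ) ≠ 0 := by positivity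
  rw [node, gridX_rotate]; field_simp; ring

lemma gridY_node (hM : 1 ≤ M) (i j : ℕ) : gridY ω M (node ω M i j) = j := by
  have : (M : ℝ) ≠ 0 := by positivity
  rw [node, gridY_rotate]; field_simp; ring

lemma rotate_gridX_gridY (hM : 1 ≤ M) (p : ℝ × ℝ) :
    rotate ω (-1 + 2 * gridX ω M p / M, -1 + 2 * gridY ω M p / M) = p := by
  have : (M : ℝ) ≠ 0 := by positivity
  have h := Real.sin_sq_add_cos_sq ω
  ext
  · simp only [gridX, gridY, rotate]
    field_simp
    linear_combination p.1 * h
  · simp only [gridX, gridY, rotate]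
    field_simp
    linear_combination p.2 * h

lemma mem_domain_iff (hM : 1 ≤ M) (p : ℝ × ℝ) :
    p ∈ domain ω ↔ (0 < gridX ω M p ∧ gridX ω M p < M) ∧ (0 < gridY ω M p ∧ gridY ω M p < M) := by
  have hM' : (0 : ℝ) < M := by positivity
  constructor
  · rintro ⟨⟨x, y⟩, ⟨⟨hx1, hx2⟩, hy1, hy2⟩, rfl⟩
    rw [gridX_rotate, gridY_rotate]
    simp only at hx1 hx2 hy1 hy2
    refine ⟨⟨by nlinarith, by nlinarith⟩, by nlinarith, by nlinarith⟩
  · rintro ⟨⟨hx1, hx2⟩, hy1, hy2⟩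
    refine ⟨_, ⟨⟨?_, ?_⟩, ?_, ?_⟩, rotate_gridX_gridY hM p⟩ <;> simp only
    · linarith [show 0 < 2 * gridX ω M p / M by positivity]
    · have : 2 * gridX ω M p / M < 2 := by rw [div_lt_iff₀ hM']; linarith
      linarith
    · linarith [show 0 < 2 * gridY ω M p / M by positivity]
    · have : 2 * gridY ω M p / M < 2 := by rw [div_lt_iff₀ hM']; linarith
      linarith

lemma gridX_convexComb {a b : ℝ} (hab : a + b = 1) (p q : ℝ × ℝ) :
    gridX ω M (a • p + b • q) = a * gridX ω M p + b * gridX ω M q := by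
  simp only [gridX, Prod.fst_add, Prod.snd_add, Prod.smul_fst, Prod.smul_snd, smul_eq_mul]
  linear_combination (-(M / 2) : ℝ) * hab

lemma gridY_convexComb {a b : ℝ} (hab : a + b = 1) (p q : ℝ × ℝ) :
    gridY ω M (a • p + b • q) = a * gridY ω M p + b * gridY ω M q := by
  simp only [gridY, Prod.fst_add, Prod.snd_add, Prod.smul_fst, Prod.smul_snd, smul_eq_mul]
  linear_combination (-(M / 2) : ℝ) * hab

lemma mem_convexHull_triple {p x y z : ℝ × ℝ} {a b c : ℝ} (ha : 0 ≤ a) (hb : 0 ≤ b) (hc : 0 ≤ c)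
    (habc : a + b + c = 1) (hp : p = a • x + b • y + c • z) :
    p ∈ convexHull ℝ ({x, y, z} : Set (ℝ × ℝ)) := by
  have hS := convex_convexHull ℝ ({x, y, z} : Set (ℝ × ℝ))
  have hx : x ∈ convexHull ℝ ({x, y, z} : Set (ℝ × ℝ)) := subset_convexHull _ _ (by simp)
  have hy : y ∈ convexHull ℝ ({x, y, z} : Set (ℝ × ℝ)) := subset_convexHull _ _ (by simp)
  have hz : z ∈ convexHull ℝ ({x, y, z} : Set (ℝ × ℝ)) := subset_convexHull _ _ (by simp)
  have := hS.sum_mem (t := Finset.univ) (w := ![a, b, c]) (z := ![x, y, z])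
    (by intro i _; fin_cases i <;> simpa) (by simp [Fin.sum_univ_three, habc])
    (by intro i _; fin_cases i <;> simpa)
  rw [hp]
  simpa [Fin.sum_univ_three] using this

/-- The vertices of the triangle below the diagonal of the grid square `(i, j)`. -/
def lowerVerts (ω : ℝ) (M i j : ℕ) : Set (ℝ × ℝ) :=
  {node ω M i j, node ω M (i + 1) j, node ω M (i + 1) (j + 1)}

/-- The vertices of the triangle above the diagonal of the grid square `(i, j)`. -/
def upperVerts (ω : ℝ) (M i j : ℕ) : Set (ℝ × ℝ) :=
  {node ω M i j, node ω M i (j + 1), node ω M (i + 1) (j + 1)}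

lemma mem_lower_iff (hM : 1 ≤ M) (i j : ℕ) (p : ℝ × ℝ) :
    p ∈ convexHull ℝ (lowerVerts ω M i j) ↔
      j ≤ gridY ω M p ∧ gridY ω M p - j ≤ gridX ω M p - i ∧ gridX ω M p ≤ i + 1 := by
  constructor
  · have hc : Convex ℝ {p | (j : ℝ) ≤ gridY ω M p ∧ gridY ω M p - j ≤ gridX ω M p - i ∧
        gridX ω M p ≤ i + 1} := by
      rintro p ⟨h1, h2, h3⟩ q ⟨h4, h5, h6⟩ a b ha hb hab
      simp only [mem_ofPred_eq, gridX_convexComb hab, gridY_convexComb hab]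
      have hb' : b = 1 - a := by linarith
      subst hb'
      refine ⟨by nlinarith, by nlinarith, by nlinarith⟩
    intro hp
    refine convexHull_min ?_ hc hp
    rintro q (rfl | rfl | rfl) <;>
      simp [gridX_node hM, gridY_node hM, add_comm]
  · rintro ⟨h1, h2, h3⟩
    refine mem_convexHull_triple (a := i + 1 - gridX ω M p)
      (b := (gridX ω M p - i) - (gridY ω M p - j)) (c := gridY ω M p - j)
      (by linarith) (by linarith) (by linarith) (by ring) ?_
    have : (M : ℝ) ≠ 0 := by positivity
    conv_lhs => rw [← rotate_gridX_gridY (ω := ω) hM p]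
    ext
    · simp only [rotate, node, Prod.fst_add, Prod.smul_fst, smul_eq_mul]
      push_cast
      field_simp
      ring
    · simp only [rotate, node, Prod.snd_add, Prod.smul_snd, smul_eq_mul]
      push_cast
      field_simp
      ring

lemma mem_upper_iff (hM : 1 ≤ M) (i j : ℕ) (p : ℝ × ℝ) :
    p ∈ convexHull ℝ (upperVerts ω M i j) ↔
      i ≤ gridX ω M p ∧ gridX ω M p - i ≤ gridY ω M p - j ∧ gridY ω M p ≤ j + 1 := by
  constructor
  · have hc : Convex ℝ {p | (i : ℝ) ≤ gridX ω M p ∧ gridX ω M p - i ≤ gridY ω M p - j ∧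
        gridY ω M p ≤ j + 1} := by
      rintro p ⟨h1, h2, h3⟩ q ⟨h4, h5, h6⟩ a b ha hb hab
      simp only [mem_ofPred_eq, gridX_convexComb hab, gridY_convexComb hab]
      have hb' : b = 1 - a := by linarith
      subst hb'
      refine ⟨by nlinarith, by nlinarith, by nlinarith⟩
    intro hp
    refine convexHull_min ?_ hc hp
    rintro q (rfl | rfl | rfl) <;>
      simp [gridX_node hM, gridY_node hM, add_comm]
  · rintro ⟨h1, h2, h3⟩
    refine mem_convexHull_triple (a := j + 1 - gridY ω M p)
      (b := (gridY ω M p - j) - (gridX ω M p - i)) (c := gridX ω M p - i)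
      (by linarith) (by linarith) (by linarith) (by ring) ?_
    have : (M : ℝ) ≠ 0 := by positivity
    conv_lhs => rw [← rotate_gridX_gridY (ω := ω) hM p]
    ext
    · simp only [rotate, node, Prod.fst_add, Prod.smul_fst, smul_eq_mul]
      push_cast
      field_simp
      ring
    · simp only [rotate, node, Prod.snd_add, Prod.smul_snd, smul_eq_mul]
      push_cast
      field_simp
      ring

lemma lowerVerts_mem_mesh {i j : ℕ} (hi : i < M) (hj : j < M) : lowerVerts ω M i j ∈ mesh ω M :=
  ⟨i, hi, j, hj, Or.inl rfl⟩

lemma upperVerts_mem_mesh {i j : ℕ} (hi : i < M) (hj : j < M) : upperVerts ω M i j ∈ mesh ω M :=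
  ⟨i, hi, j, hj, Or.inr rfl⟩

/-- The triangles cover the domain. -/
lemma exists_triangle_of_mem_domain (hM : 1 ≤ M) {p : ℝ × ℝ} (hp : p ∈ domain ω) :
    ∃ S ∈ mesh ω M, p ∈ convexHull ℝ S := by
  obtain ⟨⟨hx1, hx2⟩, hy1, hy2⟩ := (mem_domain_iff hM p).1 hp
  have hi : ⌊gridX ω M p⌋₊ < M := (Nat.floor_lt hx1.le).2 hx2
  have hj : ⌊gridY ω M p⌋₊ < M := (Nat.floor_lt hy1.le).2 hy2
  have h1 := Nat.floor_le hx1.le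
  have h2 := Nat.floor_le hy1.le
  have h3 := (Nat.lt_floor_add_one (gridX ω M p)).le
  have h4 := (Nat.lt_floor_add_one (gridY ω M p)).le
  rcases le_total (gridY ω M p - ⌊gridY ω M p⌋₊) (gridX ω M p - ⌊gridX ω M p⌋₊) with h | h
  · exact ⟨_, lowerVerts_mem_mesh hi hj, (mem_lower_iff hM _ _ p).2 ⟨h2, h, h3⟩⟩
  · exact ⟨_, upperVerts_mem_mesh hi hj, (mem_upper_iff hM _ _ p).2 ⟨h1, h, h4⟩⟩

/-! ### Hat functions and nodal interpolation -/

/-- An affine function of the grid coordinates is an affine function on the plane. -/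
lemma exists_affine_of_grid {u : ℝ × ℝ → ℝ} {S : Set (ℝ × ℝ)} (A B D : ℝ)
    (h : ∀ p ∈ S, u p = A * gridX ω M p + B * gridY ω M p + D) :
    ∃ a b c : ℝ, ∀ p ∈ S, u p = a * p.1 + b * p.2 + c := by
  refine ⟨M / 2 * (A * Real.cos ω - B * Real.sin ω), M / 2 * (A * Real.sin ω + B * Real.cos ω),
    M / 2 * (A + B) + D, fun p hp => ?_⟩
  rw [h p hp, gridX, gridY]
  ring

/-- The nodal basis function of the node `(i, j)`.  Its level sets are the hexagons formed by the
six triangles around the node. -/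
noncomputable def hat (ω : ℝ) (M i j : ℕ) (p : ℝ × ℝ) : ℝ :=
  max 0 (1 - max (max |gridX ω M p - i| |gridY ω M p - j|)
    |(gridX ω M p - i) - (gridY ω M p - j)|)

lemma continuous_hat (i j : ℕ) : Continuous (hat ω M i j) := by
  unfold hat
  have := continuous_gridX (ω := ω) (M := M)
  have := continuous_gridY (ω := ω) (M := M)
  fun_prop

lemma hat_eq_zero {i j : ℕ} {p : ℝ × ℝ} (h : 1 ≤ |gridX ω M p - i| ∨ 1 ≤ |gridY ω M p - j| ∨
    1 ≤ |(gridX ω M p - i) - (gridY ω M p - j)|) : hat ω M i j p = 0 := by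
  refine max_eq_left ?_
  have : 1 ≤ max (max |gridX ω M p - i| |gridY ω M p - j|)
    |(gridX ω M p - i) - (gridY ω M p - j)| := by simpa [le_max_iff, or_assoc] using h
  linarith

lemma hat_eq_one_sub {i j : ℕ} {p : ℝ × ℝ} {t : ℝ} (ht : t ≤ 1) (hx : |gridX ω M p - i| ≤ t)
    (hy : |gridY ω M p - j| ≤ t) (hxy : |(gridX ω M p - i) - (gridY ω M p - j)| ≤ t)
    (h : t ≤ |gridX ω M p - i| ∨ t ≤ |gridY ω M p - j| ∨
      t ≤ |(gridX ω M p - i) - (gridY ω M p - j)|) : hat ω M i j p = 1 - t := by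
  have : max (max |gridX ω M p - i| |gridY ω M p - j|)
      |(gridX ω M p - i) - (gridY ω M p - j)| = t :=
    le_antisymm (max_le (max_le hx hy) hxy) (by simpa [le_max_iff, or_assoc] using h)
  rw [hat, this, max_eq_right (by linarith)]

lemma hat_node (hM : 1 ≤ M) (i j k l : ℕ) :
    hat ω M i j (node ω M k l) = if i = k ∧ j = l then 1 else 0 := by
  split_ifs with h
  · obtain ⟨rfl, rfl⟩ := h
    simp [hat, gridX_node hM, gridY_node hM]
  · apply hat_eq_zero
    rw [gridX_node hM, gridY_node hM]
    by_cases h1 : i = k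
    · have h2 : (l : ℤ) - j ≠ 0 := fun h2 => h ⟨h1, by omega⟩
      right; left
      exact_mod_cast Int.one_le_abs h2
    · have h2 : (k : ℤ) - i ≠ 0 := by omega
      left
      exact_mod_cast Int.one_le_abs h2

lemma one_le_abs_of_natCast_lt {k i : ℕ} {x : ℝ} (h1 : (k : ℝ) ≤ x) (h2 : x ≤ k + 1)
    (h : i ≠ k) (h' : i ≠ k + 1) : 1 ≤ |x - i| := by
  rcases lt_or_gt_of_ne h with h3 | h3
  · have : (i : ℝ) + 1 ≤ k := by exact_mod_cast h3
    exact le_abs.2 (Or.inl (by linarith))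
  · have : (k : ℝ) + 1 + 1 ≤ i := by exact_mod_cast (show k + 1 + 1 ≤ i by omega)
    exact le_abs.2 (Or.inr (by linarith))

lemma hat_affine_lower (hM : 1 ≤ M) (i j k l : ℕ) :
    ∃ a b c : ℝ, ∀ p ∈ convexHull ℝ (lowerVerts ω M k l),
      hat ω M i j p = a * p.1 + b * p.2 + c := by
  by_cases h00 : i = k ∧ j = l
  · obtain ⟨rfl, rfl⟩ := h00
    refine exists_affine_of_grid (ω := ω) (M := M) (-1) 0 (1 + i) fun p hp => ?_
    obtain ⟨h1, h2, h3⟩ := (mem_lower_iff hM _ _ p).1 hp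
    rw [hat_eq_one_sub (t := gridX ω M p - i) (by linarith)]
    · ring
    · exact abs_le.2 ⟨by linarith, by linarith⟩
    · exact abs_le.2 ⟨by linarith, by linarith⟩
    · exact abs_le.2 ⟨by linarith, by linarith⟩
    · exact Or.inl (le_abs.2 (Or.inl (by linarith)))
  by_cases h10 : i = k + 1 ∧ j = l
  · obtain ⟨rfl, rfl⟩ := h10
    refine exists_affine_of_grid (ω := ω) (M := M) 1 (-1) (j - k) fun p hp => ?_
    obtain ⟨h1, h2, h3⟩ := (mem_lower_iff hM _ _ p).1 hp
    rw [hat_eq_one_sub (t := 1 - (gridX ω M p - k) + (gridY ω M p - j)) (by linarith)]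
    · ring
    · push_cast; exact abs_le.2 ⟨by linarith, by linarith⟩
    · exact abs_le.2 ⟨by linarith, by linarith⟩
    · push_cast; exact abs_le.2 ⟨by linarith, by linarith⟩
    · push_cast; exact Or.inr (Or.inr (le_abs.2 (Or.inr (by linarith))))
  by_cases h11 : i = k + 1 ∧ j = l + 1
  · obtain ⟨rfl, rfl⟩ := h11
    refine exists_affine_of_grid (ω := ω) (M := M) 0 1 (-l) fun p hp => ?_
    obtain ⟨h1, h2, h3⟩ := (mem_lower_iff hM _ _ p).1 hp
    rw [hat_eq_one_sub (t := 1 - (gridY ω M p - l)) (by linarith)]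
    · ring
    · push_cast; exact abs_le.2 ⟨by linarith, by linarith⟩
    · push_cast; exact abs_le.2 ⟨by linarith, by linarith⟩
    · push_cast; exact abs_le.2 ⟨by linarith, by linarith⟩
    · push_cast; exact Or.inr (Or.inl (le_abs.2 (Or.inr (by linarith))))
  · refine exists_affine_of_grid (ω := ω) (M := M) 0 0 0 fun p hp => ?_
    obtain ⟨h1, h2, h3⟩ := (mem_lower_iff hM _ _ p).1 hp
    rw [hat_eq_zero]
    · ring
    by_cases hi : i ≠ k ∧ i ≠ k + 1
    · exact Or.inl (one_le_abs_of_natCast_lt (by linarith) h3 hi.1 hi.2)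
    by_cases hj : j ≠ l ∧ j ≠ l + 1
    · exact Or.inr (Or.inl (one_le_abs_of_natCast_lt h1 (by linarith) hj.1 hj.2))
    obtain ⟨rfl, rfl⟩ : i = k ∧ j = l + 1 := by omega
    right; right
    push_cast
    exact le_abs.2 (Or.inl (by linarith))

lemma hat_affine_upper (hM : 1 ≤ M) (i j k l : ℕ) :
    ∃ a b c : ℝ, ∀ p ∈ convexHull ℝ (upperVerts ω M k l),
      hat ω M i j p = a * p.1 + b * p.2 + c := by
  by_cases h00 : i = k ∧ j = l
  · obtain ⟨rfl, rfl⟩ := h00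
    refine exists_affine_of_grid (ω := ω) (M := M) 0 (-1) (1 + j) fun p hp => ?_
    obtain ⟨h1, h2, h3⟩ := (mem_upper_iff hM _ _ p).1 hp
    rw [hat_eq_one_sub (t := gridY ω M p - j) (by linarith)]
    · ring
    · exact abs_le.2 ⟨by linarith, by linarith⟩
    · exact abs_le.2 ⟨by linarith, by linarith⟩
    · exact abs_le.2 ⟨by linarith, by linarith⟩
    · exact Or.inr (Or.inl (le_abs.2 (Or.inl (by linarith))))
  by_cases h10 : i = k ∧ j = l + 1
  · obtain ⟨rfl, rfl⟩ := h10
    refine exists_affine_of_grid (ω := ω) (M := M) (-1) 1 (i - l) fun p hp => ?_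
    obtain ⟨h1, h2, h3⟩ := (mem_upper_iff hM _ _ p).1 hp
    rw [hat_eq_one_sub (t := 1 + (gridX ω M p - i) - (gridY ω M p - l)) (by linarith)]
    · ring
    · exact abs_le.2 ⟨by linarith, by linarith⟩
    · push_cast; exact abs_le.2 ⟨by linarith, by linarith⟩
    · push_cast; exact abs_le.2 ⟨by linarith, by linarith⟩
    · push_cast; exact Or.inr (Or.inr (le_abs.2 (Or.inl (by linarith))))
  by_cases h11 : i = k + 1 ∧ j = l + 1
  · obtain ⟨rfl, rfl⟩ := h11
    refine exists_affine_of_grid (ω := ω) (M := M) 1 0 (-k) fun p hp => ?_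
    obtain ⟨h1, h2, h3⟩ := (mem_upper_iff hM _ _ p).1 hp
    rw [hat_eq_one_sub (t := 1 - (gridX ω M p - k)) (by linarith)]
    · ring
    · push_cast; exact abs_le.2 ⟨by linarith, by linarith⟩
    · push_cast; exact abs_le.2 ⟨by linarith, by linarith⟩
    · push_cast; exact abs_le.2 ⟨by linarith, by linarith⟩
    · push_cast; exact Or.inl (le_abs.2 (Or.inr (by linarith)))
  · refine exists_affine_of_grid (ω := ω) (M := M) 0 0 0 fun p hp => ?_
    obtain ⟨h1, h2, h3⟩ := (mem_upper_iff hM _ _ p).1 hp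
    rw [hat_eq_zero]
    · ring
    by_cases hi : i ≠ k ∧ i ≠ k + 1
    · exact Or.inl (one_le_abs_of_natCast_lt h1 (by linarith) hi.1 hi.2)
    by_cases hj : j ≠ l ∧ j ≠ l + 1
    · exact Or.inr (Or.inl (one_le_abs_of_natCast_lt (by linarith) h3 hj.1 hj.2))
    obtain ⟨rfl, rfl⟩ : i = k + 1 ∧ j = l := by omega
    right; right
    push_cast
    exact le_abs.2 (Or.inr (by linarith))

lemma hat_mem_femSpace (hM : 1 ≤ M) {i j : ℕ} (hi : 0 < i ∧ i < M) (hj : 0 < j ∧ j < M) :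
    hat ω M i j ∈ femSpace ω M := by
  refine ⟨continuous_hat i j, fun p hp => hat_eq_zero ?_, ?_⟩
  · by_contra! h
    refine hp ((mem_domain_iff hM p).2 ?_)
    have h1 : (1 : ℝ) ≤ i := by exact_mod_cast hi.1
    have h2 : (i : ℝ) + 1 ≤ M := by exact_mod_cast hi.2
    have h3 : (1 : ℝ) ≤ j := by exact_mod_cast hj.1
    have h4 : (j : ℝ) + 1 ≤ M := by exact_mod_cast hj.2
    have h5 := abs_lt.1 h.1
    have h6 := abs_lt.1 h.2.1
    refine ⟨⟨by linarith, by linarith⟩, by linarith, by linarith⟩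
  · rintro S ⟨k, hk, l, hl, rfl | rfl⟩
    · exact hat_affine_lower hM i j k l
    · exact hat_affine_upper hM i j k l

/-- Every grid function vanishing at the boundary nodes is the vector of nodal values of a finite
element function. -/
theorem exists_interpolant (hM : 1 ≤ M) (g : ℕ → ℕ → ℝ)
    (hg : ∀ i j, ¬ ((0 < i ∧ i < M) ∧ (0 < j ∧ j < M)) → g i j = 0) :
    ∃ u ∈ femSpace ω M, ∀ i ≤ M, ∀ j ≤ M, u (node ω M i j) = g i j := by
  refine ⟨∑ i ∈ Finset.range (M + 1), ∑ j ∈ Finset.range (M + 1), g i j • hat ω M i j,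
    Submodule.sum_mem _ fun i _ => Submodule.sum_mem _ fun j _ => ?_, fun k hk l hl => ?_⟩
  · by_cases h : (0 < i ∧ i < M) ∧ (0 < j ∧ j < M)
    · exact Submodule.smul_mem _ _ (hat_mem_femSpace hM h.1 h.2)
    · rw [hg i j h, zero_smul]
      exact zero_mem _
  · simp only [Finset.sum_apply, Pi.smul_apply, hat_node hM, smul_eq_mul]
    rw [Finset.sum_eq_single k, Finset.sum_eq_single l]
    · simp
    · intro j _ hj; simp [hj]
    · intro h; exact absurd (Finset.mem_range.2 (by omega)) h
    · intro i _ hi; simp [hi]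
    · intro h; exact absurd (Finset.mem_range.2 (by omega)) h

/-! ### The energy form in terms of nodal values -/

/-- The nodal values of a function on the `M × M` grid. -/
noncomputable def nodal (ω : ℝ) (M : ℕ) (u : ℝ × ℝ → ℝ) (i j : ℕ) : ℝ := u (node ω M i j)

/-- The `x`-derivative, times the grid size, of the linear interpolant of the grid function `g` on
the lower triangle of the grid square `(i, j)`. -/
noncomputable def lowX (ω : ℝ) (g : ℕ → ℕ → ℝ) (i j : ℕ) : ℝ :=
  Real.cos ω * (g (i + 1) j - g i j) - Real.sin ω * (g (i + 1) (j + 1) - g (i + 1) j)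

/-- The `y`-derivative, times the grid size, on the lower triangle. -/
noncomputable def lowY (ω : ℝ) (g : ℕ → ℕ → ℝ) (i j : ℕ) : ℝ :=
  Real.sin ω * (g (i + 1) j - g i j) + Real.cos ω * (g (i + 1) (j + 1) - g (i + 1) j)

/-- The `x`-derivative, times the grid size, on the upper triangle. -/
noncomputable def upX (ω : ℝ) (g : ℕ → ℕ → ℝ) (i j : ℕ) : ℝ :=
  Real.cos ω * (g (i + 1) (j + 1) - g i (j + 1)) - Real.sin ω * (g i (j + 1) - g i j)

/-- The `y`-derivative, times the grid size, on the upper triangle. -/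
noncomputable def upY (ω : ℝ) (g : ℕ → ℕ → ℝ) (i j : ℕ) : ℝ :=
  Real.sin ω * (g (i + 1) (j + 1) - g i (j + 1)) + Real.cos ω * (g i (j + 1) - g i j)

/-- The contribution of the grid square `(i, j)` to the energy form, up to a constant factor. -/
noncomputable def cellForm (ω ε : ℝ) (g g' : ℕ → ℕ → ℝ) (i j : ℕ) : ℝ :=
  (lowX ω g i j * lowX ω g' i j + ε * (lowY ω g i j * lowY ω g' i j)) +
    (upX ω g i j * upX ω g' i j + ε * (upY ω g i j * upY ω g' i j))

/-- The open triangles of the grid square `(i, j)`: the lower one for `false`, the upper one for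
`true`. -/
def openTriangle (ω : ℝ) (M : ℕ) : ℕ × ℕ × Bool → Set (ℝ × ℝ)
  | (i, j, false) => {p | (j : ℝ) < gridY ω M p ∧ gridY ω M p - j < gridX ω M p - i ∧
      gridX ω M p < i + 1}
  | (i, j, true) => {p | (i : ℝ) < gridX ω M p ∧ gridX ω M p - i < gridY ω M p - j ∧
      gridY ω M p < j + 1}

lemma isOpen_openTriangle (T : ℕ × ℕ × Bool) : IsOpen (openTriangle ω M T) := by
  have hX := continuous_gridX (ω := ω) (M := M)
  have hY := continuous_gridY (ω := ω) (M := M)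
  obtain ⟨i, j, _ | _⟩ := T
  · exact (isOpen_lt continuous_const hY).inter
      ((isOpen_lt (hY.sub continuous_const) (hX.sub continuous_const)).inter
        (isOpen_lt hX continuous_const))
  · exact (isOpen_lt continuous_const hX).inter
      ((isOpen_lt (hX.sub continuous_const) (hY.sub continuous_const)).inter
        (isOpen_lt hY continuous_const))

lemma openTriangle_disjoint {T T' : ℕ × ℕ × Bool} (h : T ≠ T') :
    Disjoint (openTriangle ω M T) (openTriangle ω M T') := by
  rw [Set.disjoint_left]
  intro p hp hp'
  apply h
  have key : ∀ (k l : ℕ) (x : ℝ), (k : ℝ) < x → x < k + 1 → (l : ℝ) < x → x < l + 1 → k = l := by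
    intro k l x h1 h2 h3 h4
    have h5 : k < l + 1 := by exact_mod_cast h1.trans h4
    have h6 : l < k + 1 := by exact_mod_cast h3.trans h2
    omega
  obtain ⟨i, j, _ | _⟩ := T <;> obtain ⟨i', j', _ | _⟩ := T' <;>
    obtain ⟨h1, h2, h3⟩ := hp <;> obtain ⟨h4, h5, h6⟩ := hp' <;>
    obtain rfl := key i i' (gridX ω M p) (by linarith) (by linarith) (by linarith) (by linarith) <;>
    obtain rfl := key j j' (gridY ω M p) (by linarith) (by linarith) (by linarith) (by linarith)
  · rfl
  · linarith
  · linarith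
  · rfl

lemma openTriangle_subset_domain (hM : 1 ≤ M) {i j : ℕ} (hi : i < M) (hj : j < M) (b : Bool) :
    openTriangle ω M (i, j, b) ⊆ domain ω := by
  intro p hp
  rw [mem_domain_iff hM]
  have hi0 : (0 : ℝ) ≤ i := by positivity
  have hj0 : (0 : ℝ) ≤ j := by positivity
  have hi' : (i : ℝ) + 1 ≤ M := by exact_mod_cast hi
  have hj' : (j : ℝ) + 1 ≤ M := by exact_mod_cast hj
  cases b <;> obtain ⟨h1, h2, h3⟩ := hp <;>
    exact ⟨⟨by linarith, by linarith⟩, by linarith, by linarith⟩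

/-- Lines are null sets. -/
lemma volume_line (α β γ : ℝ) (h : α ≠ 0 ∨ β ≠ 0) :
    volume {p : ℝ × ℝ | α * p.1 + β * p.2 = γ} = 0 := by
  rcases Set.eq_empty_or_nonempty {p : ℝ × ℝ | α * p.1 + β * p.2 = γ} with h0 | ⟨p₀, hp₀⟩
  · rw [h0, measure_empty]
  let f : ℝ × ℝ →ₗ[ℝ] ℝ := α • LinearMap.fst ℝ ℝ ℝ + β • LinearMap.snd ℝ ℝ ℝ
  have hf : LinearMap.ker f ≠ ⊤ := by
    intro hf
    rw [LinearMap.ker_eq_top] at hf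
    have h1 := LinearMap.congr_fun hf (1, 0)
    have h2 := LinearMap.congr_fun hf (0, 1)
    simp [f] at h1 h2
    tauto
  refine measure_mono_null ?_ (Measure.addHaar_affineSubspace volume
    (AffineSubspace.mk' p₀ (LinearMap.ker f)) fun h => hf ?_)
  · intro p hp
    have hp₀' : α * p₀.1 + β * p₀.2 = γ := hp₀
    have hp' : α * p.1 + β * p.2 = γ := hp
    simp only [SetLike.mem_coe, AffineSubspace.mem_mk', vsub_eq_sub, LinearMap.mem_ker, f,
      LinearMap.add_apply, LinearMap.smul_apply, LinearMap.fst_apply, LinearMap.snd_apply,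
      Prod.fst_sub, Prod.snd_sub, smul_eq_mul]
    linarith
  · rw [← AffineSubspace.direction_mk' p₀ (LinearMap.ker f), h, AffineSubspace.direction_top]

lemma volume_line_grid (hM : 1 ≤ M) (A B D : ℝ) (h : A ≠ 0 ∨ B ≠ 0) :
    volume {p : ℝ × ℝ | A * gridX ω M p + B * gridY ω M p = D} = 0 := by
  have hM' : (M : ℝ) ≠ 0 := by positivity
  have hsc := Real.sin_sq_add_cos_sq ω
  have h' : A * Real.cos ω - B * Real.sin ω ≠ 0 ∨ A * Real.sin ω + B * Real.cos ω ≠ 0 := by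
    by_contra! h0
    obtain ⟨h1, h2⟩ := h0
    have hA : A = 0 := by
      linear_combination (-A) * hsc + Real.cos ω * h1 + Real.sin ω * h2
    have hB : B = 0 := by
      linear_combination (-B) * hsc - Real.sin ω * h1 + Real.cos ω * h2
    tauto
  rw [← volume_line (A * Real.cos ω - B * Real.sin ω) (A * Real.sin ω + B * Real.cos ω)
    (D * 2 / M - A - B) h']
  congr 1
  ext p
  simp only [mem_ofPred_eq, gridX, gridY]
  constructor
  · intro h
    rw [← h]; field_simp; ring
  · intro h
    have : D * 2 / M = (A * Real.cos ω - B * Real.sin ω) * p.1 +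
      (A * Real.sin ω + B * Real.cos ω) * p.2 + A + B := by linarith
    field_simp at this
    linarith

/-- The indices of the triangles of the grid. -/
def triangleIndices (M : ℕ) : Finset (ℕ × ℕ × Bool) :=
  Finset.range M ×ˢ Finset.range M ×ˢ Finset.univ

/-- The open triangles exhaust the domain up to the grid lines, which are null sets. -/
lemma domain_ae_eq (hM : 1 ≤ M) :
    domain ω =ᵐ[volume] ⋃ T ∈ triangleIndices M, openTriangle ω M T := by
  refine (ae_eq_set).2 ⟨?_, ?_⟩
  · refine measure_mono_null (t := ⋃ k : ℤ, ({p | 1 * gridX ω M p + 0 * gridY ω M p = k} ∪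
      ({p | 0 * gridX ω M p + 1 * gridY ω M p = k} ∪
        {p | 1 * gridX ω M p + (-1) * gridY ω M p = k}))) ?_ ?_
    · rintro p ⟨hp, hp'⟩
      by_contra hcon
      simp only [mem_iUnion, mem_union, mem_ofPred_eq, not_exists, not_or, one_mul, zero_mul,
        zero_add, add_zero, neg_mul] at hcon
      obtain ⟨⟨hx1, hx2⟩, hy1, hy2⟩ := (mem_domain_iff hM p).1 hp
      have hi : ⌊gridX ω M p⌋₊ < M := (Nat.floor_lt hx1.le).2 hx2
      have hj : ⌊gridY ω M p⌋₊ < M := (Nat.floor_lt hy1.le).2 hy2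
      have h1 := lt_of_le_of_ne (Nat.floor_le hx1.le)
        (fun h => (hcon ⌊gridX ω M p⌋₊).1 (by exact_mod_cast h.symm))
      have h2 := lt_of_le_of_ne (Nat.floor_le hy1.le)
        (fun h => (hcon ⌊gridY ω M p⌋₊).2.1 (by exact_mod_cast h.symm))
      have h3 := Nat.lt_floor_add_one (gridX ω M p)
      have h4 := Nat.lt_floor_add_one (gridY ω M p)
      have h5 := (hcon (⌊gridX ω M p⌋₊ - ⌊gridY ω M p⌋₊)).2.2
      push_cast at h5
      apply hp'
      simp only [mem_iUnion]
      rcases lt_trichotomy (gridY ω M p - ⌊gridY ω M p⌋₊) (gridX ω M p - ⌊gridX ω M p⌋₊)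
        with h | h | h
      · exact ⟨(_, _, false), by simpa [triangleIndices] using ⟨hi, hj⟩, h2, h, h3⟩
      · exact absurd (by linarith) h5
      · exact ⟨(_, _, true), by simpa [triangleIndices] using ⟨hi, hj⟩, h1, h, h4⟩
    · refine measure_iUnion_null fun k => measure_union_null ?_ (measure_union_null ?_ ?_) <;>
        exact volume_line_grid hM _ _ _ (by norm_num)
  · convert measure_empty (μ := volume)
    rw [Set.sdiff_eq_empty]
    refine iUnion₂_subset fun T hT => ?_
    obtain ⟨i, j, b⟩ := T
    simp only [triangleIndices, Finset.mem_product, Finset.mem_range] at hT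
    exact openTriangle_subset_domain hM hT.1 hT.2.1 b

/-- All triangles have the same area: translations move the lower ones to each other, and point
reflections take lower triangles to upper ones. -/
lemma volume_openTriangle (hM : 1 ≤ M) (T : ℕ × ℕ × Bool) :
    volume (openTriangle ω M T) = volume (openTriangle ω M (0, 0, false)) := by
  have hM' : (M : ℝ) ≠ 0 := by positivity
  have hX : ∀ p q, gridX ω M (p + q) = gridX ω M p + gridX ω M q - M / 2 := by
    intro p q; simp only [gridX, Prod.fst_add, Prod.snd_add]; ring
  have hY : ∀ p q, gridY ω M (p + q) = gridY ω M p + gridY ω M q - M / 2 := by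
    intro p q; simp only [gridY, Prod.fst_add, Prod.snd_add]; ring
  have hXn : ∀ p, gridX ω M (-p) = M - gridX ω M p := by
    intro p; simp only [gridX, Prod.fst_neg, Prod.snd_neg]; ring
  have hYn : ∀ p, gridY ω M (-p) = M - gridY ω M p := by
    intro p; simp only [gridY, Prod.fst_neg, Prod.snd_neg]; ring
  obtain ⟨i, j, _ | _⟩ := T
  · rw [← measure_preimage_add_right volume (rotate ω (-2 * i / M, -2 * j / M))
      (openTriangle ω M (0, 0, false))]
    congr 1
    ext p
    have e1 : gridX ω M (p + rotate ω (-2 * i / M, -2 * j / M)) = gridX ω M p - i := by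
      rw [hX, gridX_rotate]; field_simp; ring
    have e2 : gridY ω M (p + rotate ω (-2 * i / M, -2 * j / M)) = gridY ω M p - j := by
      rw [hY, gridY_rotate]; field_simp; ring
    simp only [openTriangle, mem_preimage, mem_ofPred_eq, e1, e2, Nat.cast_zero, sub_zero, zero_add]
    constructor <;> rintro ⟨h1, h2, h3⟩ <;> exact ⟨by linarith, by linarith, by linarith⟩
  · -- the point reflection in the midpoint of the diagonal exchanges the two triangles of a square
    rw [← measure_preimage_add_right volume (rotate ω (2 * (i + 1) / M - 2, 2 * (j + 1) / M - 2))
      (openTriangle ω M (0, 0, false)),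
      ← Measure.measure_preimage_neg volume
        ((fun p => p + rotate ω (2 * (i + 1) / M - 2, 2 * (j + 1) / M - 2)) ⁻¹' _)]
    congr 1
    ext p
    have e1 : gridX ω M (-p + rotate ω (2 * (i + 1) / M - 2, 2 * (j + 1) / M - 2)) =
        i + 1 - gridX ω M p := by
      rw [hX, gridX_rotate, hXn]; field_simp; ring
    have e2 : gridY ω M (-p + rotate ω (2 * (i + 1) / M - 2, 2 * (j + 1) / M - 2)) =
        j + 1 - gridY ω M p := by
      rw [hY, gridY_rotate, hYn]; field_simp; ring
    simp only [openTriangle, mem_preimage, mem_ofPred_eq, e1, e2, Nat.cast_zero, sub_zero, zero_add]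
    constructor <;> rintro ⟨h1, h2, h3⟩ <;> exact ⟨by linarith, by linarith, by linarith⟩

lemma openTriangle_false_subset (hM : 1 ≤ M) (i j : ℕ) :
    openTriangle ω M (i, j, false) ⊆ convexHull ℝ (lowerVerts ω M i j) := fun p hp =>
  (mem_lower_iff hM i j p).2 ⟨hp.1.le, hp.2.1.le, hp.2.2.le⟩

lemma openTriangle_true_subset (hM : 1 ≤ M) (i j : ℕ) :
    openTriangle ω M (i, j, true) ⊆ convexHull ℝ (upperVerts ω M i j) := fun p hp =>
  (mem_upper_iff hM i j p).2 ⟨hp.1.le, hp.2.1.le, hp.2.2.le⟩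

lemma volume_openTriangle_lt_top (hM : 1 ≤ M) (T : ℕ × ℕ × Bool) :
    volume (openTriangle ω M T) < ∞ := by
  rw [volume_openTriangle hM]
  refine (measure_mono (openTriangle_false_subset hM 0 0)).trans_lt ?_
  have hfin : (lowerVerts ω M 0 0).Finite := by
    unfold lowerVerts
    exact Set.toFinite _
  exact (hfin.isCompact_convexHull ℝ).measure_lt_top

lemma fderiv_of_affine {u : ℝ × ℝ → ℝ} {U : Set (ℝ × ℝ)} (hU : IsOpen U) {a b c : ℝ}
    (h : ∀ p ∈ U, u p = a * p.1 + b * p.2 + c) {p : ℝ × ℝ} (hp : p ∈ U) :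
    fderiv ℝ u p (1, 0) = a ∧ fderiv ℝ u p (0, 1) = b := by
  have h1 : HasFDerivAt (fun q : ℝ × ℝ => a * q.1 + b * q.2 + c)
      (a • ContinuousLinearMap.fst ℝ ℝ ℝ + b • ContinuousLinearMap.snd ℝ ℝ ℝ) p :=
    ((hasFDerivAt_fst.const_mul a).add (hasFDerivAt_snd.const_mul b)).add_const c
  have h2 : u =ᶠ[nhds p] fun q => a * q.1 + b * q.2 + c :=
    Filter.eventually_of_mem (hU.mem_nhds hp) h
  rw [(h1.congr_of_eventuallyEq h2).fderiv]
  simp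

lemma fderiv_lower (hM : 1 ≤ M) {u : ℝ × ℝ → ℝ} (hu : u ∈ femSpace ω M) {i j : ℕ} (hi : i < M)
    (hj : j < M) {p : ℝ × ℝ} (hp : p ∈ openTriangle ω M (i, j, false)) :
    fderiv ℝ u p (1, 0) = M / 2 * lowX ω (nodal ω M u) i j ∧
      fderiv ℝ u p (0, 1) = M / 2 * lowY ω (nodal ω M u) i j := by
  have hM' : (M : ℝ) ≠ 0 := by positivity
  obtain ⟨a, b, c, h⟩ := hu.2.2 _ (lowerVerts_mem_mesh hi hj)
  obtain ⟨h1, h2⟩ := fderiv_of_affine (isOpen_openTriangle _)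
    (fun q hq => h q (openTriangle_false_subset hM i j hq)) hp
  have hsc := Real.sin_sq_add_cos_sq ω
  rw [h1, h2]
  simp only [lowX, lowY, nodal]
  rw [h (node ω M i j) (subset_convexHull _ _ (by simp [lowerVerts])),
    h (node ω M (i + 1) j) (subset_convexHull _ _ (by simp [lowerVerts])),
    h (node ω M (i + 1) (j + 1)) (subset_convexHull _ _ (by simp [lowerVerts]))]
  simp only [node, rotate]
  push_cast
  constructor
  · field_simp
    linear_combination (-2 * a) * hsc
  · field_simp
    linear_combination (-2 * b) * hsc

lemma fderiv_upper (hM : 1 ≤ M) {u : ℝ × ℝ → ℝ} (hu : u ∈ femSpace ω M) {i j : ℕ} (hi : i < M)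
    (hj : j < M) {p : ℝ × ℝ} (hp : p ∈ openTriangle ω M (i, j, true)) :
    fderiv ℝ u p (1, 0) = M / 2 * upX ω (nodal ω M u) i j ∧
      fderiv ℝ u p (0, 1) = M / 2 * upY ω (nodal ω M u) i j := by
  have hM' : (M : ℝ) ≠ 0 := by positivity
  obtain ⟨a, b, c, h⟩ := hu.2.2 _ (upperVerts_mem_mesh hi hj)
  obtain ⟨h1, h2⟩ := fderiv_of_affine (isOpen_openTriangle _)
    (fun q hq => h q (openTriangle_true_subset hM i j hq)) hp
  have hsc := Real.sin_sq_add_cos_sq ω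
  rw [h1, h2]
  simp only [upX, upY, nodal]
  rw [h (node ω M i j) (subset_convexHull _ _ (by simp [upperVerts])),
    h (node ω M i (j + 1)) (subset_convexHull _ _ (by simp [upperVerts])),
    h (node ω M (i + 1) (j + 1)) (subset_convexHull _ _ (by simp [upperVerts]))]
  simp only [node, rotate]
  push_cast
  constructor
  · field_simp
    linear_combination (-2 * a) * hsc
  · field_simp
    linear_combination (-2 * b) * hsc

/-- The energy form is a quadratic form in the nodal values.  The area of the triangles enters only
through the constant `A`, since all triangles are congruent. -/
theorem energyForm_eq_sum (ω : ℝ) (hM : 1 ≤ M) :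
    ∃ A : ℝ, 0 ≤ A ∧ ∀ ε : ℝ, ∀ u ∈ femSpace ω M, ∀ v ∈ femSpace ω M,
      energyForm ω ε u v = A * ∑ i ∈ Finset.range M, ∑ j ∈ Finset.range M,
        cellForm ω ε (nodal ω M u) (nodal ω M v) i j := by
  refine ⟨(volume (openTriangle ω M (0, 0, false))).toReal * (M / 2) ^ 2, by positivity,
    fun ε u hu v hv => ?_⟩
  set f : ℝ × ℝ → ℝ := fun p => fderiv ℝ u p (1, 0) * fderiv ℝ v p (1, 0)
      + ε * (fderiv ℝ u p (0, 1) * fderiv ℝ v p (0, 1)) with hf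
  let κ : ℕ × ℕ × Bool → ℝ := fun T => (M / 2) ^ 2 * (match T with
    | (i, j, false) => lowX ω (nodal ω M u) i j * lowX ω (nodal ω M v) i j +
        ε * (lowY ω (nodal ω M u) i j * lowY ω (nodal ω M v) i j)
    | (i, j, true) => upX ω (nodal ω M u) i j * upX ω (nodal ω M v) i j +
        ε * (upY ω (nodal ω M u) i j * upY ω (nodal ω M v) i j))
  have hκ : ∀ T ∈ triangleIndices M, EqOn f (fun _ => κ T) (openTriangle ω M T) := by
    rintro ⟨i, j, b⟩ hT p hp
    simp only [triangleIndices, Finset.mem_product, Finset.mem_range] at hT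
    cases b
    · obtain ⟨h1, h2⟩ := fderiv_lower hM hu hT.1 hT.2.1 hp
      obtain ⟨h3, h4⟩ := fderiv_lower hM hv hT.1 hT.2.1 hp
      simp only [hf, κ, h1, h2, h3, h4]
      ring
    · obtain ⟨h1, h2⟩ := fderiv_upper hM hu hT.1 hT.2.1 hp
      obtain ⟨h3, h4⟩ := fderiv_upper hM hv hT.1 hT.2.1 hp
      simp only [hf, κ, h1, h2, h3, h4]
      ring
  have hmeas : ∀ T, MeasurableSet (openTriangle ω M T) := fun T =>
    (isOpen_openTriangle T).measurableSet
  have hint : ∀ T ∈ triangleIndices M, IntegrableOn f (openTriangle ω M T) := fun T hT =>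
    (integrableOn_congr_fun (hκ T hT) (hmeas T)).2
      (integrableOn_const (volume_openTriangle_lt_top hM T).ne)
  calc energyForm ω ε u v = ∫ p in domain ω, f p := rfl
    _ = ∫ p in ⋃ T ∈ triangleIndices M, openTriangle ω M T, f p :=
        setIntegral_congr_set (domain_ae_eq hM)
    _ = ∑ T ∈ triangleIndices M, ∫ p in openTriangle ω M T, f p :=
        integral_biUnion_finset _ (fun T _ => hmeas T)
          (fun T _ T' _ h => openTriangle_disjoint h) hint
    _ = ∑ T ∈ triangleIndices M, (volume (openTriangle ω M (0, 0, false))).toReal * κ T := by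
        refine Finset.sum_congr rfl fun T hT => ?_
        rw [setIntegral_congr_fun (hmeas T) (hκ T hT), setIntegral_const, smul_eq_mul,
          Measure.real, volume_openTriangle hM]
    _ = _ := by
        rw [← Finset.mul_sum, mul_assoc]
        congr 1
        rw [triangleIndices, Finset.sum_product, Finset.mul_sum]
        refine Finset.sum_congr rfl fun i _ => ?_
        rw [Finset.sum_product, Finset.mul_sum]
        refine Finset.sum_congr rfl fun j _ => ?_
        rw [Fintype.sum_bool]
        simp only [κ, cellForm]
        ring

/-! ### Successive subspace correction in an inner product space -/

section Abstract

variable {H : Type*} [NormedAddCommGroup H] [InnerProductSpace ℝ H]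

/-- In a sweep of successive orthogonal corrections `x (n + 1) = x n - d n`, the squares of the
norms of the corrections add up to the total decrease of the squared norm. -/
lemma norm_sq_sweep (x : ℕ → H) (L : ℕ)
    (hx : ∀ n < L, inner ℝ (x (n + 1)) (x n - x (n + 1)) = 0) :
    ‖x 0‖ ^ 2 = ‖x L‖ ^ 2 + ∑ n ∈ Finset.range L, ‖x n - x (n + 1)‖ ^ 2 := by
  induction L with
  | zero => simp
  | succ L ih =>
    rw [ih fun n hn => hx n (by omega), Finset.sum_range_succ]
    have h := norm_add_sq_real (x (L + 1)) (x L - x (L + 1))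
    rw [hx L (by omega)] at h
    rw [add_sub_cancel] at h
    linarith

/-- A sweep of orthogonal corrections in subspaces `W 0, …, W (L - 1)`, preceded by an orthogonal
correction `v ↦ x 0`, contracts with a factor that depends only on the constant of a decomposition
`x 0 - z₀ = ∑ z n`, where `z₀` is orthogonal to `x 0`, provided that subspaces with distant indices
are orthogonal. -/
theorem sweep_contraction {C : ℝ} (hC : 1 ≤ C) (W : ℕ → Submodule ℝ H) (L : ℕ)
    (hW : ∀ m n, m + 9 ≤ n → ∀ y ∈ W m, ∀ z ∈ W n, inner ℝ y z = 0)
    (v : H) (x : ℕ → H) (hv : inner ℝ (x 0) (v - x 0) = 0)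
    (hx : ∀ n < L, x n - x (n + 1) ∈ W n ∧ ∀ z ∈ W n, inner ℝ (x (n + 1)) z = 0)
    (v₀ : H) (hv₀ : inner ℝ (x 0) v₀ = 0) (z : ℕ → H) (hz : ∀ n < L, z n ∈ W n)
    (hsum : v = v₀ + ∑ n ∈ Finset.range L, z n)
    (hstab : ∑ n ∈ Finset.range L, ‖z n‖ ^ 2 ≤ C * ‖v‖ ^ 2) :
    ‖x L‖ ^ 2 ≤ (1 - 1 / (108 * C)) * ‖v‖ ^ 2 := by
  set d : ℕ → H := fun n => x n - x (n + 1) with hd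
  set S := ∑ n ∈ Finset.range L, ‖d n‖ ^ 2 with hS
  have hSnn : 0 ≤ S := Finset.sum_nonneg fun _ _ => by positivity
  have h1 : ‖x 0‖ ^ 2 = ‖x L‖ ^ 2 + S :=
    norm_sq_sweep x L fun n hn => (hx n hn).2 _ (hx n hn).1
  have h2 : ‖v‖ ^ 2 = ‖x 0‖ ^ 2 + ‖v - x 0‖ ^ 2 := by
    have h := norm_add_sq_real (x 0) (v - x 0)
    rw [hv, add_sub_cancel] at h
    linarith
  have h3 : ‖x 0‖ ^ 2 = ∑ n ∈ Finset.range L, inner ℝ (x 0) (z n) := by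
    have : inner ℝ (x 0) v = inner ℝ (x 0) (x 0) := by
      rw [inner_sub_right] at hv; linarith
    rw [← real_inner_self_eq_norm_sq, ← this, hsum, inner_add_right, hv₀, zero_add, inner_sum]
  -- only the last nine corrections before the `n`-th block are seen by `z n`
  have h4 : ∀ n < L, inner ℝ (x 0) (z n) = ∑ m ∈ Finset.range L,
      if m ≤ n ∧ n < m + 9 then inner ℝ (d m) (z n) else 0 := by
    intro n hn
    have e1 : x 0 = x (n + 1) + ∑ m ∈ Finset.range (n + 1), d m := by
      rw [Finset.sum_range_sub']; abel
    rw [e1, inner_add_left, (hx n hn).2 _ (hz n hn), zero_add, sum_inner]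
    have e2 : Finset.range (n + 1) ⊆ Finset.range L := Finset.range_subset_range.2 (by omega)
    rw [← Finset.sum_subset e2]
    · refine Finset.sum_congr rfl fun m hm => ?_
      have hm' := Finset.mem_range.1 hm
      split_ifs with h
      · rfl
      · exact hW m n (by omega) _ (hx m (by omega)).1 _ (hz n hn)
    · intro m _ hm
      rw [Finset.mem_range] at hm
      exact if_neg (by omega)
  have hcard1 : ∀ n, ((Finset.range L).filter fun m => m ≤ n ∧ n < m + 9).card ≤ 9 := by
    intro n
    calc _ ≤ (Finset.Icc (n - 8) n).card := Finset.card_le_card fun m hm => by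
            rw [Finset.mem_filter] at hm; rw [Finset.mem_Icc]; omega
      _ ≤ 9 := by rw [Nat.card_Icc]; omega
  have hcard2 : ∀ m, ((Finset.range L).filter fun n => m ≤ n ∧ n < m + 9).card ≤ 9 := by
    intro m
    calc _ ≤ (Finset.Icc m (m + 8)).card := Finset.card_le_card fun n hn => by
            rw [Finset.mem_filter] at hn; rw [Finset.mem_Icc]; omega
      _ ≤ 9 := by rw [Nat.card_Icc]; omega
  -- the weight `18 * C` makes the contribution of the `z n` at most `‖v‖ ^ 2 / 4`
  have h5 : ∀ m n, (if m ≤ n ∧ n < m + 9 then inner ℝ (d m) (z n) else 0) ≤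
      (if m ≤ n ∧ n < m + 9 then 9 * C * ‖d m‖ ^ 2 else 0) +
        (if m ≤ n ∧ n < m + 9 then ‖z n‖ ^ 2 / (36 * C) else 0) := by
    intro m n
    split_ifs
    · refine (real_inner_le_norm _ _).trans ?_
      have : 9 * C * ‖d m‖ ^ 2 + ‖z n‖ ^ 2 / (36 * C) - ‖d m‖ * ‖z n‖ =
          (18 * C * ‖d m‖ - ‖z n‖) ^ 2 / (36 * C) := by
        field_simp; ring
      have : 0 ≤ (18 * C * ‖d m‖ - ‖z n‖) ^ 2 / (36 * C) := by positivity
      linarith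
    · simp
  have h6 : ‖x 0‖ ^ 2 ≤ 81 * C * S + ‖v‖ ^ 2 / 4 := by
    calc ‖x 0‖ ^ 2 = ∑ n ∈ Finset.range L, ∑ m ∈ Finset.range L,
          (if m ≤ n ∧ n < m + 9 then inner ℝ (d m) (z n) else 0) := by
          rw [h3]
          exact Finset.sum_congr rfl fun n hn => h4 n (Finset.mem_range.1 hn)
      _ ≤ ∑ n ∈ Finset.range L, ∑ m ∈ Finset.range L,
          ((if m ≤ n ∧ n < m + 9 then 9 * C * ‖d m‖ ^ 2 else 0) +
            (if m ≤ n ∧ n < m + 9 then ‖z n‖ ^ 2 / (36 * C) else 0)) :=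
          Finset.sum_le_sum fun n _ => Finset.sum_le_sum fun m _ => h5 m n
      _ = (∑ m ∈ Finset.range L, ∑ n ∈ Finset.range L,
            (if m ≤ n ∧ n < m + 9 then 9 * C * ‖d m‖ ^ 2 else 0)) +
          ∑ n ∈ Finset.range L, ∑ m ∈ Finset.range L,
            (if m ≤ n ∧ n < m + 9 then ‖z n‖ ^ 2 / (36 * C) else 0) := by
          simp only [Finset.sum_add_distrib]
          rw [Finset.sum_comm]
      _ ≤ (∑ m ∈ Finset.range L, 9 * (9 * C * ‖d m‖ ^ 2)) +
          ∑ n ∈ Finset.range L, 9 * (‖z n‖ ^ 2 / (36 * C)) := by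
          refine add_le_add (Finset.sum_le_sum fun m _ => ?_) (Finset.sum_le_sum fun n _ => ?_)
          · rw [← Finset.sum_filter, Finset.sum_const, nsmul_eq_mul]
            exact mul_le_mul_of_nonneg_right (by exact_mod_cast hcard2 m) (by positivity)
          · rw [← Finset.sum_filter, Finset.sum_const, nsmul_eq_mul]
            exact mul_le_mul_of_nonneg_right (by exact_mod_cast hcard1 n) (by positivity)
      _ = 81 * C * S + (∑ n ∈ Finset.range L, ‖z n‖ ^ 2) / (4 * C) := by
          rw [hS, Finset.mul_sum, Finset.sum_div]
          congr 1 <;> refine Finset.sum_congr rfl fun n _ => ?_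
          · ring
          · field_simp; ring
      _ ≤ 81 * C * S + ‖v‖ ^ 2 / 4 := by
          refine add_le_add le_rfl ?_
          rw [div_le_div_iff₀ (by positivity) (by norm_num)]
          linarith
  have h7 : ‖v‖ ^ 2 ≤ 108 * C * (‖v‖ ^ 2 - ‖x L‖ ^ 2) := by
    have : ‖v‖ ^ 2 - ‖x L‖ ^ 2 = ‖v - x 0‖ ^ 2 + S := by linarith
    rw [this]
    nlinarith [sq_nonneg ‖v - x 0‖, mul_nonneg (sub_nonneg.2 hC) (sq_nonneg ‖v - x 0‖)]
  have h8 : ‖v‖ ^ 2 / (108 * C) ≤ ‖v‖ ^ 2 - ‖x L‖ ^ 2 := by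
    rw [div_le_iff₀ (by positivity)]; linarith
  have h9 : (1 - 1 / (108 * C)) * ‖v‖ ^ 2 = ‖v‖ ^ 2 - ‖v‖ ^ 2 / (108 * C) := by ring
  linarith

end Abstract

/-! ### Energy projections -/

/-- The energy form on finite element functions is the pullback of the inner product of a
Euclidean space under a linear map which depends on the nodal values only. -/
theorem exists_gradientMap (ω : ℝ) {ε : ℝ} (hε : 0 ≤ ε) {M : ℕ} (hM : 1 ≤ M) :
    ∃ G : (ℝ × ℝ → ℝ) →ₗ[ℝ] EuclideanSpace ℝ (Fin M × Fin M × Fin 4),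
      (∀ u ∈ femSpace ω M, ∀ v ∈ femSpace ω M, energyForm ω ε u v = inner ℝ (G u) (G v)) ∧
      (∀ u v : ℝ × ℝ → ℝ, (∀ i ≤ M, ∀ j ≤ M, nodal ω M u i j = nodal ω M v i j) → G u = G v) := by
  obtain ⟨A, hA, h⟩ := energyForm_eq_sum ω hM
  let g : (ℝ × ℝ → ℝ) → Fin M × Fin M × Fin 4 → ℝ := fun u k => √A *
    (![lowX ω (nodal ω M u) k.1 k.2.1, √ε * lowY ω (nodal ω M u) k.1 k.2.1,
      upX ω (nodal ω M u) k.1 k.2.1, √ε * upY ω (nodal ω M u) k.1 k.2.1] k.2.2)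
  refine ⟨{ toFun := fun u => WithLp.toLp 2 (g u), map_add' := ?_, map_smul' := ?_ }, ?_, ?_⟩
  · intro u v
    ext ⟨i, j, k⟩
    fin_cases k <;> simp [g, lowX, lowY, upX, upY, nodal] <;> ring
  · intro t u
    ext ⟨i, j, k⟩
    fin_cases k <;> simp [g, lowX, lowY, upX, upY, nodal] <;> ring
  · intro u hu v hv
    rw [h ε u hu v hv]
    simp only [LinearMap.coe_mk, AddHom.coe_mk, PiLp.inner_apply, Fintype.sum_prod_type, g,
      Fin.sum_univ_four]
    rw [Finset.mul_sum, Finset.sum_range]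
    refine Finset.sum_congr rfl fun i _ => ?_
    rw [Finset.mul_sum, Finset.sum_range]
    refine Finset.sum_congr rfl fun j _ => ?_
    have hA' := Real.mul_self_sqrt hA
    have hε' := Real.mul_self_sqrt hε
    simp only [cellForm, Nat.succ_eq_add_one, Nat.reduceAdd, Fin.isValue, Matrix.cons_val_zero,
      RCLike.inner_apply, Real.ringHom_apply, Matrix.cons_val_one, Matrix.cons_val]
    set x1 := lowX ω (nodal ω M u) i j
    set x2 := lowY ω (nodal ω M u) i j
    set x3 := upX ω (nodal ω M u) i j
    set x4 := upY ω (nodal ω M u) i j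
    set y1 := lowX ω (nodal ω M v) i j
    set y2 := lowY ω (nodal ω M v) i j
    set y3 := upX ω (nodal ω M v) i j
    set y4 := upY ω (nodal ω M v) i j
    linear_combination (-(x1 * y1 + √ε * √ε * (x2 * y2) + x3 * y3 + √ε * √ε * (x4 * y4))) * hA'
      - A * (x2 * y2 + x4 * y4) * hε'
  · intro u v huv
    ext ⟨i, j, k⟩
    have hi := i.2
    have hj := j.2
    have e1 := huv i (by omega) j (by omega)
    have e2 := huv (i + 1) (by omega) j (by omega)
    have e3 := huv i (by omega) (j + 1) (by omega)
    have e4 := huv (i + 1) (by omega) (j + 1) (by omega)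
    fin_cases k <;> simp [g, lowX, lowY, upX, upY, e1, e2, e3, e4]

/-- The energy projection onto a subspace of the finite element space has its defining
properties. -/
theorem energyProj_spec {ω ε : ℝ} (hε : 0 ≤ ε) {M : ℕ} (hM : 1 ≤ M)
    {W : Submodule ℝ (ℝ × ℝ → ℝ)} (hW : W ≤ femSpace ω M) {v : ℝ × ℝ → ℝ}
    (hv : v ∈ femSpace ω M) :
    energyProj ω ε W v ∈ W ∧ ∀ z ∈ W, energyForm ω ε (v - energyProj ω ε W v) z = 0 := by
  obtain ⟨G, hG, -⟩ := exists_gradientMap ω hε hM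
  have hex : ∃ w ∈ W, ∀ z ∈ W, energyForm ω ε (v - w) z = 0 := by
    obtain ⟨y, hy, hy'⟩ := (W.map G).exists_norm_eq_iInf_of_complete_subspace
      (W.map G).complete_of_finiteDimensional (G v)
    rw [(W.map G).norm_eq_iInf_iff_real_inner_eq_zero hy] at hy'
    obtain ⟨w, hw, rfl⟩ := hy
    refine ⟨w, hw, fun z hz => ?_⟩
    rw [hG _ (sub_mem hv (hW hw)) _ (hW hz), map_sub]
    exact hy' _ (Submodule.mem_map_of_mem hz)
  rw [energyProj, dif_pos hex]
  exact hex.choose_spec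

/-! ### Energy estimates on a single triangle -/

/-- The key estimate: multiplication by a cut-off function `t` of the strongly coupled direction
increases the `x`-derivative on a triangle only by a multiple of `c * s * (c + s) * w`.  Here `w₀`,
`w₁`, `w₂` are nodal values, and `s`, `c`, `c + s` are the height differences along the three edges,
which bound the increments of `t`. -/
lemma slopeX_cutoff_le {c s t₀ t₁ t₂ w₀ w₁ w₂ : ℝ} (hcs : s ^ 2 + c ^ 2 = 1)
    (h₀ : |t₀| ≤ 1) (h₁ : |t₁| ≤ 1) (h₂ : |t₂| ≤ 1) (h₀₁ : |t₁ - t₀| ≤ 2 * |s|)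
    (h₁₂ : |t₂ - t₁| ≤ 2 * |c|) (h₀₂ : |t₂ - t₀| ≤ 2 * |c + s|) :
    (c * (t₁ * w₁ - t₀ * w₀) - s * (t₂ * w₂ - t₁ * w₁)) ^ 2 ≤
      9 * (c * (w₁ - w₀) - s * (w₂ - w₁)) ^ 2 +
        24 * ((c * s * (c + s)) ^ 2 * (w₀ ^ 2 + w₁ ^ 2 + w₂ ^ 2)) := by
  set r := c * (w₁ - w₀) - s * (w₂ - w₁) with hr
  set R := c * (t₁ * w₁ - t₀ * w₀) - s * (t₂ * w₂ - t₁ * w₁) with hR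
  have sq3 : ∀ x y z : ℝ, (x + y + z) ^ 2 ≤ 3 * (x ^ 2 + y ^ 2 + z ^ 2) := fun x y z => by
    nlinarith [sq_nonneg (x - y), sq_nonneg (y - z), sq_nonneg (x - z)]
  have hsq : ∀ {x y : ℝ}, |x| ≤ 2 * |y| → x ^ 2 ≤ 4 * y ^ 2 := fun {x y} h => by
    have := sq_le_sq' (by linarith [abs_nonneg x, abs_nonneg y]) h
    rwa [sq_abs, mul_pow, sq_abs, show (2 : ℝ) ^ 2 = 4 by norm_num] at this
  have hone : ∀ {x : ℝ}, |x| ≤ 1 → x ^ 2 ≤ 1 := fun h => (sq_le_one_iff_abs_le_one _).2 h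
  -- in each case one vertex serves as base point, and the estimate is multiplied by the height
  -- difference of the opposite edge; the squares of the three factors add up to at least `1`
  have e0 : c * R = c * t₀ * r + (c + s) * c * (t₁ - t₀) * w₁ + -s * c * (t₂ - t₀) * w₂ := by
    rw [hR, hr]; ring
  have e1 : (c + s) * R = (c + s) * t₁ * r + (c + s) * c * (t₁ - t₀) * w₀ +
      -s * (c + s) * (t₂ - t₁) * w₂ := by
    rw [hR, hr]; ring
  have e2 : s * R = s * t₂ * r + s * c * (t₂ - t₀) * w₀ + -(c + s) * s * (t₂ - t₁) * w₁ := by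
    rw [hR, hr]; ring
  clear_value r R
  have mulsq : ∀ {a x K : ℝ}, x ^ 2 ≤ K → (a * x) ^ 2 ≤ a ^ 2 * K := fun {a x K} h => by
    rw [mul_pow]; exact mul_le_mul_of_nonneg_left h (sq_nonneg a)
  have f0 : (c * R) ^ 2 ≤ 3 * (c ^ 2 * r ^ 2 + 4 * ((c * s * (c + s)) ^ 2 * w₁ ^ 2) +
      4 * ((c * s * (c + s)) ^ 2 * w₂ ^ 2)) := by
    rw [e0]
    refine (sq3 _ _ _).trans (mul_le_mul_of_nonneg_left (add_le_add (add_le_add ?_ ?_) ?_)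
      (by norm_num))
    · linarith [mulsq (a := c * r) (hone h₀)]
    · linarith [mulsq (a := (c + s) * c * w₁) (hsq h₀₁)]
    · linarith [mulsq (a := s * c * w₂) (hsq h₀₂)]
  have f1 : ((c + s) * R) ^ 2 ≤ 3 * ((c + s) ^ 2 * r ^ 2 +
      4 * ((c * s * (c + s)) ^ 2 * w₀ ^ 2) + 4 * ((c * s * (c + s)) ^ 2 * w₂ ^ 2)) := by
    rw [e1]
    refine (sq3 _ _ _).trans (mul_le_mul_of_nonneg_left (add_le_add (add_le_add ?_ ?_) ?_)
      (by norm_num))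
    · linarith [mulsq (a := (c + s) * r) (hone h₁)]
    · linarith [mulsq (a := (c + s) * c * w₀) (hsq h₀₁)]
    · linarith [mulsq (a := s * (c + s) * w₂) (hsq h₁₂)]
  have f2 : (s * R) ^ 2 ≤ 3 * (s ^ 2 * r ^ 2 + 4 * ((c * s * (c + s)) ^ 2 * w₀ ^ 2) +
      4 * ((c * s * (c + s)) ^ 2 * w₁ ^ 2)) := by
    rw [e2]
    refine (sq3 _ _ _).trans (mul_le_mul_of_nonneg_left (add_le_add (add_le_add ?_ ?_) ?_)
      (by norm_num))
    · linarith [mulsq (a := s * r) (hone h₂)]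
    · linarith [mulsq (a := s * c * w₀) (hsq h₀₂)]
    · linarith [mulsq (a := (c + s) * s * w₁) (hsq h₁₂)]
  have g1 : (c + s) ^ 2 ≤ 2 := by nlinarith [sq_nonneg (c - s)]
  have g2 : R ^ 2 ≤ (c * R) ^ 2 + (s * R) ^ 2 + ((c + s) * R) ^ 2 := by
    have : (c * R) ^ 2 + (s * R) ^ 2 = R ^ 2 := by linear_combination R ^ 2 * hcs
    linarith [sq_nonneg ((c + s) * R)]
  have g3 : c ^ 2 * r ^ 2 + s ^ 2 * r ^ 2 = r ^ 2 := by linear_combination r ^ 2 * hcs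
  have g4 : (c + s) ^ 2 * r ^ 2 ≤ 2 * r ^ 2 := mul_le_mul_of_nonneg_right g1 (sq_nonneg r)
  linarith

lemma slopeY_cutoff_le {c s t₀ t₁ t₂ w₀ w₁ w₂ : ℝ} (hcs : s ^ 2 + c ^ 2 = 1)
    (h₁ : |t₁| ≤ 1) (h₀₁ : |t₁ - t₀| ≤ 2 * |s|) (h₁₂ : |t₂ - t₁| ≤ 2 * |c|) :
    (s * (t₁ * w₁ - t₀ * w₀) + c * (t₂ * w₂ - t₁ * w₁)) ^ 2 ≤
      3 * (s * (w₁ - w₀) + c * (w₂ - w₁)) ^ 2 + 12 * (w₀ ^ 2 + w₁ ^ 2 + w₂ ^ 2) := by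
  set q := s * (w₁ - w₀) + c * (w₂ - w₁) with hq
  have sq3 : ∀ x y z : ℝ, (x + y + z) ^ 2 ≤ 3 * (x ^ 2 + y ^ 2 + z ^ 2) := fun x y z => by
    nlinarith [sq_nonneg (x - y), sq_nonneg (y - z), sq_nonneg (x - z)]
  have hsq : ∀ {x y : ℝ}, |x| ≤ 2 * |y| → x ^ 2 ≤ 4 * y ^ 2 := fun {x y} h => by
    have := sq_le_sq' (by linarith [abs_nonneg x, abs_nonneg y]) h
    rwa [sq_abs, mul_pow, sq_abs, show (2 : ℝ) ^ 2 = 4 by norm_num] at this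
  have e : s * (t₁ * w₁ - t₀ * w₀) + c * (t₂ * w₂ - t₁ * w₁) =
      t₁ * q + s * (t₁ - t₀) * w₀ + c * (t₂ - t₁) * w₂ := by rw [hq]; ring
  rw [e]
  refine (sq3 _ _ _).trans ?_
  have hq1 : (t₁ * q) ^ 2 ≤ q ^ 2 := by
    nlinarith [mul_le_mul_of_nonneg_left ((sq_le_one_iff_abs_le_one _).2 h₁) (sq_nonneg q)]
  have hs2 : s ^ 2 * s ^ 2 ≤ 1 := by nlinarith [sq_nonneg s, sq_nonneg c]
  have hc2 : c ^ 2 * c ^ 2 ≤ 1 := by nlinarith [sq_nonneg s, sq_nonneg c]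
  have h2 : (s * (t₁ - t₀) * w₀) ^ 2 ≤ 4 * w₀ ^ 2 := by
    nlinarith [mul_le_mul_of_nonneg_left (hsq h₀₁) (sq_nonneg (s * w₀)),
      mul_le_mul_of_nonneg_right hs2 (sq_nonneg w₀)]
  have h3 : (c * (t₂ - t₁) * w₂) ^ 2 ≤ 4 * w₂ ^ 2 := by
    nlinarith [mul_le_mul_of_nonneg_left (hsq h₁₂) (sq_nonneg (c * w₂)),
      mul_le_mul_of_nonneg_right hc2 (sq_nonneg w₂)]
  linarith [sq_nonneg w₁]

/-! ### Energy estimates on a square of the coarse grid -/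

/-- Sum of the squared `x`-slopes over the eight fine triangles of the coarse square with corners
`(0, 0)` and `(2, 2)`. -/
noncomputable def patchX (ω : ℝ) (g : ℕ → ℕ → ℝ) : ℝ :=
  (lowX ω g 0 0 ^ 2 + upX ω g 0 0 ^ 2) + (lowX ω g 0 1 ^ 2 + upX ω g 0 1 ^ 2) +
    ((lowX ω g 1 0 ^ 2 + upX ω g 1 0 ^ 2) + (lowX ω g 1 1 ^ 2 + upX ω g 1 1 ^ 2))

/-- Sum of the squared `y`-slopes over the eight fine triangles of the coarse square with corners
`(0, 0)` and `(2, 2)`. -/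
noncomputable def patchY (ω : ℝ) (g : ℕ → ℕ → ℝ) : ℝ :=
  (lowY ω g 0 0 ^ 2 + upY ω g 0 0 ^ 2) + (lowY ω g 0 1 ^ 2 + upY ω g 0 1 ^ 2) +
    ((lowY ω g 1 0 ^ 2 + upY ω g 1 0 ^ 2) + (lowY ω g 1 1 ^ 2 + upY ω g 1 1 ^ 2))

lemma patchX_nonneg (ω : ℝ) (g : ℕ → ℕ → ℝ) : 0 ≤ patchX ω g := by unfold patchX; positivity

lemma patchY_nonneg (ω : ℝ) (g : ℕ → ℕ → ℝ) : 0 ≤ patchY ω g := by unfold patchY; positivity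

/-- `w` is the difference of `v` and its interpolant on the coarse square with corners `(0, 0)` and
`(2, 2)`, which is cut by the diagonal of direction `(1, 1)`. -/
structure IsInterpolationError (v w : ℕ → ℕ → ℝ) : Prop where
  w00 : w 0 0 = 0
  w20 : w 2 0 = 0
  w02 : w 0 2 = 0
  w22 : w 2 2 = 0
  w10 : w 1 0 = v 1 0 - (v 0 0 + v 2 0) / 2
  w01 : w 0 1 = v 0 1 - (v 0 0 + v 0 2) / 2
  w21 : w 2 1 = v 2 1 - (v 2 0 + v 2 2) / 2
  w12 : w 1 2 = v 1 2 - (v 0 2 + v 2 2) / 2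
  w11 : w 1 1 = v 1 1 - (v 0 0 + v 2 2) / 2

/-- The interpolation error at an edge midpoint is a second difference of `v`.  Its product with
the height differences of all three edge directions is a combination of jumps of the `x`-slope. -/
lemma IsInterpolationError.sq_le_patchX {v w : ℕ → ℕ → ℝ} (h : IsInterpolationError v w)
    (ω : ℝ) {a b : ℕ} (ha : a ≤ 2) (hb : b ≤ 2) :
    (Real.cos ω * Real.sin ω * (Real.cos ω + Real.sin ω)) ^ 2 * w a b ^ 2 ≤ 4 * patchX ω v := by
  obtain ⟨w00, w20, w02, w22, w10, w01, w21, w12, w11⟩ := h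
  have hcs := Real.sin_sq_add_cos_sq ω
  have hp := patchX_nonneg ω v
  -- the combination has the form `α * (x₁ - x₂) + β * (x₃ - x₄)` with bounded `α`, `β`
  have key : ∀ {α β x₁ x₂ x₃ x₄ y : ℝ}, α ^ 2 ≤ 2 → β ^ 2 ≤ 2 →
      y = -(α * (x₁ - x₂) + β * (x₃ - x₄)) / 2 → x₁ ^ 2 + x₂ ^ 2 ≤ patchX ω v →
      x₃ ^ 2 + x₄ ^ 2 ≤ patchX ω v → y ^ 2 ≤ 4 * patchX ω v := by
    intro α β x₁ x₂ x₃ x₄ y hα hβ hy h1 h2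
    have e1 : y ^ 2 ≤ ((α * (x₁ - x₂)) ^ 2 + (β * (x₃ - x₄)) ^ 2) / 2 := by
      rw [hy]; linarith [sq_nonneg (α * (x₁ - x₂) - β * (x₃ - x₄))]
    have e2 : (α * (x₁ - x₂)) ^ 2 ≤ 2 * (2 * (x₁ ^ 2 + x₂ ^ 2)) := by
      rw [mul_pow]
      exact mul_le_mul hα (by linarith [sq_nonneg (x₁ + x₂)]) (sq_nonneg _) (by norm_num)
    have e3 : (β * (x₃ - x₄)) ^ 2 ≤ 2 * (2 * (x₃ ^ 2 + x₄ ^ 2)) := by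
      rw [mul_pow]
      exact mul_le_mul hβ (by linarith [sq_nonneg (x₃ + x₄)]) (sq_nonneg _) (by norm_num)
    linarith
  have hc1 : Real.cos ω ^ 2 ≤ 1 := by linarith [sq_nonneg (Real.sin ω)]
  have hs1 : Real.sin ω ^ 2 ≤ 1 := by linarith [sq_nonneg (Real.cos ω)]
  have hcs2 : (Real.cos ω + Real.sin ω) ^ 2 ≤ 2 := by
    linarith [sq_nonneg (Real.cos ω - Real.sin ω)]
  have hα1 : (Real.sin ω * (Real.cos ω + Real.sin ω)) ^ 2 ≤ 2 := by
    rw [mul_pow]; linarith [mul_le_mul hs1 hcs2 (sq_nonneg _) zero_le_one]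
  have hα2 : (Real.cos ω * (Real.cos ω + Real.sin ω)) ^ 2 ≤ 2 := by
    rw [mul_pow]; linarith [mul_le_mul hc1 hcs2 (sq_nonneg _) zero_le_one]
  have hβ : (Real.cos ω * Real.sin ω) ^ 2 ≤ 2 := by
    rw [mul_pow]; linarith [mul_le_mul hc1 hs1 (sq_nonneg _) zero_le_one]
  rw [← mul_pow]
  have z1 := sq_nonneg (lowX ω v 0 0)
  have z2 := sq_nonneg (upX ω v 0 0)
  have z3 := sq_nonneg (lowX ω v 0 1)
  have z4 := sq_nonneg (upX ω v 0 1)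
  have z5 := sq_nonneg (lowX ω v 1 0)
  have z6 := sq_nonneg (upX ω v 1 0)
  have z7 := sq_nonneg (lowX ω v 1 1)
  have z8 := sq_nonneg (upX ω v 1 1)
  interval_cases a <;> interval_cases b
  · simpa [w00] using hp
  · refine key (α := -(Real.cos ω * (Real.cos ω + Real.sin ω)))
      (β := -(Real.cos ω * Real.sin ω))
      (x₁ := lowX ω v 0 1) (x₂ := upX ω v 0 0) (x₃ := upX ω v 0 1) (x₄ := lowX ω v 0 1)
      (by rwa [neg_sq]) (by rwa [neg_sq]) ?_ ?_ ?_
    · rw [w01, lowX, upX, upX]; ring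
    all_goals unfold patchX; linarith
  · simpa [w02] using hp
  · refine key (α := Real.sin ω * (Real.cos ω + Real.sin ω)) (β := -(Real.cos ω * Real.sin ω))
      (x₁ := upX ω v 1 0) (x₂ := lowX ω v 0 0) (x₃ := upX ω v 1 0) (x₄ := lowX ω v 1 0)
      hα1 (by rwa [neg_sq]) ?_ ?_ ?_
    · rw [w10, lowX, lowX, upX]; ring
    all_goals unfold patchX; linarith
  · refine key (α := Real.sin ω * (Real.cos ω + Real.sin ω))
      (β := -(Real.cos ω * (Real.cos ω + Real.sin ω)))
      (x₁ := upX ω v 1 0) (x₂ := lowX ω v 0 0) (x₃ := lowX ω v 1 1) (x₄ := upX ω v 1 0)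
      hα1 (by rwa [neg_sq]) ?_ ?_ ?_
    · rw [w11, lowX, lowX, upX]; ring
    all_goals unfold patchX; linarith
  · refine key (α := Real.sin ω * (Real.cos ω + Real.sin ω)) (β := -(Real.cos ω * Real.sin ω))
      (x₁ := upX ω v 1 1) (x₂ := lowX ω v 0 1) (x₃ := upX ω v 0 1) (x₄ := lowX ω v 0 1)
      hα1 (by rwa [neg_sq]) ?_ ?_ ?_
    · rw [w12, lowX, upX, upX]; ring
    all_goals unfold patchX; linarith
  · simpa [w20] using hp
  · refine key (α := -(Real.cos ω * (Real.cos ω + Real.sin ω)))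
      (β := -(Real.cos ω * Real.sin ω))
      (x₁ := lowX ω v 1 1) (x₂ := upX ω v 1 0) (x₃ := upX ω v 1 0) (x₄ := lowX ω v 1 0)
      (by rwa [neg_sq]) (by rwa [neg_sq]) ?_ ?_ ?_
    · rw [w21, lowX, lowX, upX]; ring
    all_goals unfold patchX; linarith
  · simpa [w22] using hp

/-- The inverse inequality for the interpolation error: at each node it is bounded by the slopes. -/
lemma IsInterpolationError.sq_le_add {v w : ℕ → ℕ → ℝ} (h : IsInterpolationError v w)
    (ω : ℝ) {a b : ℕ} (ha : a ≤ 2) (hb : b ≤ 2) :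
    w a b ^ 2 ≤ patchX ω v + patchY ω v := by
  obtain ⟨w00, w20, w02, w22, w10, w01, w21, w12, w11⟩ := h
  have hcs := Real.sin_sq_add_cos_sq ω
  have hp := add_nonneg (patchX_nonneg ω v) (patchY_nonneg ω v)
  have key : ∀ {x₁ x₂ y : ℝ}, y = (x₁ - x₂) / 2 →
      x₁ ^ 2 + x₂ ^ 2 ≤ 2 * (patchX ω v + patchY ω v) → y ^ 2 ≤ patchX ω v + patchY ω v := by
    intro x₁ x₂ y hy h1
    rw [hy]
    linarith [sq_nonneg (x₁ + x₂)]
  -- the edge differences in terms of the slopes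
  have low : ∀ i j, lowX ω v i j ^ 2 + lowY ω v i j ^ 2 =
      (v (i + 1) j - v i j) ^ 2 + (v (i + 1) (j + 1) - v (i + 1) j) ^ 2 := by
    intro i j
    rw [lowX, lowY]
    linear_combination ((v (i + 1) j - v i j) ^ 2 + (v (i + 1) (j + 1) - v (i + 1) j) ^ 2) * hcs
  have up : ∀ i j, upX ω v i j ^ 2 + upY ω v i j ^ 2 =
      (v (i + 1) (j + 1) - v i (j + 1)) ^ 2 + (v i (j + 1) - v i j) ^ 2 := by
    intro i j
    rw [upX, upY]
    linear_combination ((v (i + 1) (j + 1) - v i (j + 1)) ^ 2 + (v i (j + 1) - v i j) ^ 2) * hcs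
  have e : patchX ω v + patchY ω v =
      (lowX ω v 0 0 ^ 2 + lowY ω v 0 0 ^ 2) + (upX ω v 0 0 ^ 2 + upY ω v 0 0 ^ 2) +
      (lowX ω v 0 1 ^ 2 + lowY ω v 0 1 ^ 2) + (upX ω v 0 1 ^ 2 + upY ω v 0 1 ^ 2) +
      (lowX ω v 1 0 ^ 2 + lowY ω v 1 0 ^ 2) + (upX ω v 1 0 ^ 2 + upY ω v 1 0 ^ 2) +
      (lowX ω v 1 1 ^ 2 + lowY ω v 1 1 ^ 2) + (upX ω v 1 1 ^ 2 + upY ω v 1 1 ^ 2) := by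
    rw [patchX, patchY]; ring
  simp only [low, up] at e
  norm_num at e
  have z1 := sq_nonneg (v 1 0 - v 0 0)
  have z2 := sq_nonneg (v 1 1 - v 1 0)
  have z3 := sq_nonneg (v 1 1 - v 0 1)
  have z4 := sq_nonneg (v 0 1 - v 0 0)
  have z5 := sq_nonneg (v 1 2 - v 1 1)
  have z6 := sq_nonneg (v 1 2 - v 0 2)
  have z7 := sq_nonneg (v 0 2 - v 0 1)
  have z8 := sq_nonneg (v 2 0 - v 1 0)
  have z9 := sq_nonneg (v 2 1 - v 2 0)
  have z10 := sq_nonneg (v 2 1 - v 1 1)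
  have z11 := sq_nonneg (v 2 2 - v 2 1)
  have z12 := sq_nonneg (v 2 2 - v 1 2)
  interval_cases a <;> interval_cases b
  · simpa [w00] using hp
  · exact key (x₁ := v 0 1 - v 0 0) (x₂ := v 0 2 - v 0 1) (by rw [w01]; ring) (by linarith)
  · simpa [w02] using hp
  · exact key (x₁ := v 1 0 - v 0 0) (x₂ := v 2 0 - v 1 0) (by rw [w10]; ring) (by linarith)
  · refine key (x₁ := v 1 1 - v 0 0) (x₂ := v 2 2 - v 1 1) (by rw [w11]; ring) ?_
    linarith [sq_nonneg ((v 1 1 - v 1 0) - (v 1 0 - v 0 0)),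
      sq_nonneg ((v 2 2 - v 2 1) - (v 2 1 - v 1 1))]
  · exact key (x₁ := v 1 2 - v 0 2) (x₂ := v 2 2 - v 1 2) (by rw [w12]; ring) (by linarith)
  · simpa [w20] using hp
  · exact key (x₁ := v 2 1 - v 2 0) (x₂ := v 2 2 - v 2 1) (by rw [w21]; ring) (by linarith)
  · simpa [w22] using hp

lemma slope_error_sq_sum_le (x₁ x₂ x₃ x₄ : ℝ) :
    (x₁ - (x₁ + x₂ + x₃ - x₄) / 2) ^ 2 + (x₂ - (x₁ + x₂ + x₃ - x₄) / 2) ^ 2 +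
      (x₃ - (x₁ + x₂ + x₃ - x₄) / 2) ^ 2 + (x₄ - (x₁ + x₂ + x₃ - x₄) / 2) ^ 2 ≤
      10 * (x₁ ^ 2 + x₂ ^ 2 + x₃ ^ 2 + x₄ ^ 2) := by
  nlinarith [sq_nonneg x₁, sq_nonneg x₂, sq_nonneg x₃, sq_nonneg x₄,
    sq_nonneg (x₁ + x₂), sq_nonneg (x₁ + x₃), sq_nonneg (x₂ + x₃), sq_nonneg (x₁ - x₄),
    sq_nonneg (x₂ - x₄), sq_nonneg (x₃ - x₄), sq_nonneg (x₁ - x₂), sq_nonneg (x₁ - x₃),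
    sq_nonneg (x₂ - x₃), sq_nonneg (x₁ + x₄), sq_nonneg (x₂ + x₄), sq_nonneg (x₃ + x₄)]

/-- The slope of the coarse interpolant on a coarse triangle is half of the alternating sum of the
slopes on its four fine triangles. -/
lemma IsInterpolationError.patchX_le {v w : ℕ → ℕ → ℝ} (h : IsInterpolationError v w)
    (ω : ℝ) : patchX ω w ≤ 10 * patchX ω v := by
  obtain ⟨w00, w20, w02, w22, w10, w01, w21, w12, w11⟩ := h
  have h1 := slope_error_sq_sum_le (lowX ω v 0 0) (lowX ω v 1 0) (lowX ω v 1 1) (upX ω v 1 0)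
  have h2 := slope_error_sq_sum_le (upX ω v 0 0) (upX ω v 0 1) (upX ω v 1 1) (lowX ω v 0 1)
  set A := (lowX ω v 0 0 + lowX ω v 1 0 + lowX ω v 1 1 - upX ω v 1 0) / 2 with hA
  set B := (upX ω v 0 0 + upX ω v 0 1 + upX ω v 1 1 - lowX ω v 0 1) / 2 with hB
  have e1 : lowX ω w 0 0 = lowX ω v 0 0 - A := by
    simp only [hA, lowX, upX, zero_add, Nat.reduceAdd, w00, w10, w11]; ring
  have e2 : lowX ω w 1 0 = lowX ω v 1 0 - A := by
    simp only [hA, lowX, upX, zero_add, Nat.reduceAdd, w20, w10, w21]; ring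
  have e3 : lowX ω w 1 1 = lowX ω v 1 1 - A := by
    simp only [hA, lowX, upX, zero_add, Nat.reduceAdd, w22, w21, w11]; ring
  have e4 : upX ω w 1 0 = upX ω v 1 0 - A := by
    simp only [hA, lowX, upX, zero_add, Nat.reduceAdd, w10, w21, w11]; ring
  have e5 : upX ω w 0 0 = upX ω v 0 0 - B := by
    simp only [hB, lowX, upX, zero_add, Nat.reduceAdd, w00, w01, w11]; ring
  have e6 : upX ω w 0 1 = upX ω v 0 1 - B := by
    simp only [hB, lowX, upX, zero_add, Nat.reduceAdd, w02, w01, w12]; ring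
  have e7 : upX ω w 1 1 = upX ω v 1 1 - B := by
    simp only [hB, lowX, upX, zero_add, Nat.reduceAdd, w22, w12, w11]; ring
  have e8 : lowX ω w 0 1 = lowX ω v 0 1 - B := by
    simp only [hB, lowX, upX, zero_add, Nat.reduceAdd, w01, w12, w11]; ring
  rw [patchX, e1, e2, e3, e4, e5, e6, e7, e8, patchX]
  linarith

lemma IsInterpolationError.patchY_le {v w : ℕ → ℕ → ℝ} (h : IsInterpolationError v w)
    (ω : ℝ) : patchY ω w ≤ 10 * patchY ω v := by
  obtain ⟨w00, w20, w02, w22, w10, w01, w21, w12, w11⟩ := h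
  have h1 := slope_error_sq_sum_le (lowY ω v 0 0) (lowY ω v 1 0) (lowY ω v 1 1) (upY ω v 1 0)
  have h2 := slope_error_sq_sum_le (upY ω v 0 0) (upY ω v 0 1) (upY ω v 1 1) (lowY ω v 0 1)
  set A := (lowY ω v 0 0 + lowY ω v 1 0 + lowY ω v 1 1 - upY ω v 1 0) / 2 with hA
  set B := (upY ω v 0 0 + upY ω v 0 1 + upY ω v 1 1 - lowY ω v 0 1) / 2 with hB
  have e1 : lowY ω w 0 0 = lowY ω v 0 0 - A := by
    simp only [hA, lowY, upY, zero_add, Nat.reduceAdd, w00, w10, w11]; ring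
  have e2 : lowY ω w 1 0 = lowY ω v 1 0 - A := by
    simp only [hA, lowY, upY, zero_add, Nat.reduceAdd, w20, w10, w21]; ring
  have e3 : lowY ω w 1 1 = lowY ω v 1 1 - A := by
    simp only [hA, lowY, upY, zero_add, Nat.reduceAdd, w22, w21, w11]; ring
  have e4 : upY ω w 1 0 = upY ω v 1 0 - A := by
    simp only [hA, lowY, upY, zero_add, Nat.reduceAdd, w10, w21, w11]; ring
  have e5 : upY ω w 0 0 = upY ω v 0 0 - B := by
    simp only [hB, lowY, upY, zero_add, Nat.reduceAdd, w00, w01, w11]; ring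
  have e6 : upY ω w 0 1 = upY ω v 0 1 - B := by
    simp only [hB, lowY, upY, zero_add, Nat.reduceAdd, w02, w01, w12]; ring
  have e7 : upY ω w 1 1 = upY ω v 1 1 - B := by
    simp only [hB, lowY, upY, zero_add, Nat.reduceAdd, w22, w12, w11]; ring
  have e8 : lowY ω w 0 1 = lowY ω v 0 1 - B := by
    simp only [hB, lowY, upY, zero_add, Nat.reduceAdd, w01, w12, w11]; ring
  rw [patchY, e1, e2, e3, e4, e5, e6, e7, e8, patchY]
  linarith

/-- The properties of a cut-off function of the height, at the nodes of the grid: it is bounded by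
`1`, and its increments along an edge are bounded by twice the height difference. -/
structure IsCutoff (ω : ℝ) (t : ℕ → ℕ → ℝ) : Prop where
  le_one : ∀ i j, |t i j| ≤ 1
  horizontal : ∀ i j, |t (i + 1) j - t i j| ≤ 2 * |Real.sin ω|
  vertical : ∀ i j, |t i (j + 1) - t i j| ≤ 2 * |Real.cos ω|
  diagonal : ∀ i j, |t (i + 1) (j + 1) - t i j| ≤ 2 * |Real.cos ω + Real.sin ω|

section Cutoff

variable {t : ℕ → ℕ → ℝ}

lemma IsCutoff.lowX_sq_le (ht : IsCutoff ω t) (w : ℕ → ℕ → ℝ) (i j : ℕ) {K : ℝ}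
    (h1 : (Real.cos ω * Real.sin ω * (Real.cos ω + Real.sin ω)) ^ 2 * w i j ^ 2 ≤ K)
    (h2 : (Real.cos ω * Real.sin ω * (Real.cos ω + Real.sin ω)) ^ 2 * w (i + 1) j ^ 2 ≤ K)
    (h3 : (Real.cos ω * Real.sin ω * (Real.cos ω + Real.sin ω)) ^ 2 * w (i + 1) (j + 1) ^ 2 ≤ K) :
    lowX ω (fun i j => t i j * w i j) i j ^ 2 ≤ 9 * lowX ω w i j ^ 2 + 72 * K := by
  have := slopeX_cutoff_le (w₀ := w i j) (w₁ := w (i + 1) j) (w₂ := w (i + 1) (j + 1))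
    (Real.sin_sq_add_cos_sq ω) (ht.le_one i j) (ht.le_one (i + 1) j) (ht.le_one (i + 1) (j + 1))
    (ht.horizontal i j) (ht.vertical (i + 1) j) (ht.diagonal i j)
  unfold lowX
  linarith

lemma IsCutoff.upX_sq_le (ht : IsCutoff ω t) (w : ℕ → ℕ → ℝ) (i j : ℕ) {K : ℝ}
    (h1 : (Real.cos ω * Real.sin ω * (Real.cos ω + Real.sin ω)) ^ 2 * w i j ^ 2 ≤ K)
    (h2 : (Real.cos ω * Real.sin ω * (Real.cos ω + Real.sin ω)) ^ 2 * w i (j + 1) ^ 2 ≤ K)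
    (h3 : (Real.cos ω * Real.sin ω * (Real.cos ω + Real.sin ω)) ^ 2 * w (i + 1) (j + 1) ^ 2 ≤ K) :
    upX ω (fun i j => t i j * w i j) i j ^ 2 ≤ 9 * upX ω w i j ^ 2 + 72 * K := by
  -- exchanging the two legs turns the upper triangle into the lower one
  have := slopeX_cutoff_le (c := -Real.sin ω) (s := -Real.cos ω)
    (w₀ := w i j) (w₁ := w i (j + 1)) (w₂ := w (i + 1) (j + 1))
    (by linarith [Real.sin_sq_add_cos_sq ω]) (ht.le_one i j) (ht.le_one i (j + 1))
    (ht.le_one (i + 1) (j + 1)) (by rw [abs_neg]; exact ht.vertical i j)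
    (by rw [abs_neg]; exact ht.horizontal i (j + 1))
    (by rw [← neg_add, abs_neg, add_comm (Real.sin ω)]; exact ht.diagonal i j)
  unfold upX
  linarith

lemma IsCutoff.lowY_sq_le (ht : IsCutoff ω t) (w : ℕ → ℕ → ℝ) (i j : ℕ) {K : ℝ}
    (h1 : w i j ^ 2 ≤ K) (h2 : w (i + 1) j ^ 2 ≤ K) (h3 : w (i + 1) (j + 1) ^ 2 ≤ K) :
    lowY ω (fun i j => t i j * w i j) i j ^ 2 ≤ 3 * lowY ω w i j ^ 2 + 36 * K := by
  have := slopeY_cutoff_le (w₀ := w i j) (w₁ := w (i + 1) j) (w₂ := w (i + 1) (j + 1))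
    (Real.sin_sq_add_cos_sq ω) (ht.le_one (i + 1) j) (ht.horizontal i j) (ht.vertical (i + 1) j)
  unfold lowY
  linarith

lemma IsCutoff.upY_sq_le (ht : IsCutoff ω t) (w : ℕ → ℕ → ℝ) (i j : ℕ) {K : ℝ}
    (h1 : w i j ^ 2 ≤ K) (h2 : w i (j + 1) ^ 2 ≤ K) (h3 : w (i + 1) (j + 1) ^ 2 ≤ K) :
    upY ω (fun i j => t i j * w i j) i j ^ 2 ≤ 3 * upY ω w i j ^ 2 + 36 * K := by
  have := slopeY_cutoff_le (c := Real.sin ω) (s := Real.cos ω)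
    (w₀ := w i j) (w₁ := w i (j + 1)) (w₂ := w (i + 1) (j + 1))
    (by linarith [Real.sin_sq_add_cos_sq ω]) (ht.le_one i (j + 1)) (ht.vertical i j)
    (ht.horizontal i (j + 1))
  unfold upY
  linarith

/-- Localizing the interpolation error by a cut-off function of the height is stable in the
energy of the coarse square, uniformly in the angle and in `ε ≤ ε₀`. -/
theorem IsCutoff.patch_le (ht : IsCutoff ω t) {v w : ℕ → ℕ → ℝ} (h : IsInterpolationError v w)
    {ε ε₀ : ℝ} (hε : 0 ≤ ε) (hε₀ : ε ≤ ε₀) :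
    patchX ω (fun i j => t i j * w i j) + ε * patchY ω (fun i j => t i j * w i j) ≤
      (2394 + 318 * ε₀) * (patchX ω v + ε * patchY ω v) := by
  have hX : ∀ {a b : ℕ}, a ≤ 2 → b ≤ 2 → _ := fun {a b} => h.sq_le_patchX ω (a := a) (b := b)
  have hY : ∀ {a b : ℕ}, a ≤ 2 → b ≤ 2 → _ := fun {a b} => h.sq_le_add ω (a := a) (b := b)
  have h1 : patchX ω (fun i j => t i j * w i j) ≤ 2394 * patchX ω v := by
    have hw := h.patchX_le ω
    unfold patchX at hw ⊢
    have l := fun (i j : ℕ) (hi : i ≤ 1) (hj : j ≤ 1) => ht.lowX_sq_le w i j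
      (hX (by omega) (by omega)) (hX (by omega) (by omega)) (hX (by omega) (by omega))
    have u := fun (i j : ℕ) (hi : i ≤ 1) (hj : j ≤ 1) => ht.upX_sq_le w i j
      (hX (by omega) (by omega)) (hX (by omega) (by omega)) (hX (by omega) (by omega))
    unfold patchX at l u
    linarith [l 0 0 (by omega) (by omega), l 0 1 (by omega) (by omega), l 1 0 (by omega) (by omega),
      l 1 1 (by omega) (by omega), u 0 0 (by omega) (by omega), u 0 1 (by omega) (by omega),
      u 1 0 (by omega) (by omega), u 1 1 (by omega) (by omega)]
  have h2 : patchY ω (fun i j => t i j * w i j) ≤ 288 * patchX ω v + 318 * patchY ω v := by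
    have hw := h.patchY_le ω
    have l := fun (i j : ℕ) (hi : i ≤ 1) (hj : j ≤ 1) => ht.lowY_sq_le w i j
      (hY (by omega) (by omega)) (hY (by omega) (by omega)) (hY (by omega) (by omega))
    have u := fun (i j : ℕ) (hi : i ≤ 1) (hj : j ≤ 1) => ht.upY_sq_le w i j
      (hY (by omega) (by omega)) (hY (by omega) (by omega)) (hY (by omega) (by omega))
    set X := patchX ω v
    unfold patchY at hw l u ⊢
    linarith [l 0 0 (by omega) (by omega), l 0 1 (by omega) (by omega), l 1 0 (by omega) (by omega),
      l 1 1 (by omega) (by omega), u 0 0 (by omega) (by omega), u 0 1 (by omega) (by omega),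
      u 1 0 (by omega) (by omega), u 1 1 (by omega) (by omega)]
  have hx := patchX_nonneg ω v
  have hy := patchY_nonneg ω v
  have h3 := mul_le_mul_of_nonneg_left h2 hε
  have h4 := mul_le_mul_of_nonneg_right hε₀ hx
  have h5 : 0 ≤ (ε₀ - ε) * patchX ω v := by linarith
  have h6 : 0 ≤ ε₀ * (ε * patchY ω v) := mul_nonneg (hε.trans hε₀) (mul_nonneg hε hy)
  have h7 : 0 ≤ ε * patchX ω v := mul_nonneg hε hx
  have h8 : 0 ≤ ε * patchY ω v := mul_nonneg hε hy
  linarith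

end Cutoff

/-! ### Coarse and fine finite element functions -/

lemma gridX_two_mul (p : ℝ × ℝ) : gridX ω (2 * N) p = 2 * gridX ω N p := by
  simp only [gridX]; push_cast; ring

lemma gridY_two_mul (p : ℝ × ℝ) : gridY ω (2 * N) p = 2 * gridY ω N p := by
  simp only [gridY]; push_cast; ring

/-- Every fine triangle is contained in a coarse one. -/
lemma exists_coarse_triangle (hN : 1 ≤ N) {S : Set (ℝ × ℝ)} (hS : S ∈ mesh ω (2 * N)) :
    ∃ T ∈ mesh ω N, convexHull ℝ S ⊆ convexHull ℝ T := by
  have hM : 1 ≤ 2 * N := by omega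
  obtain ⟨k, hk, l, hl, hS⟩ := hS
  have hk' : k / 2 < N := by omega
  have hl' : l / 2 < N := by omega
  have ek : (k : ℝ) = 2 * (k / 2 : ℕ) + (k % 2 : ℕ) := by exact_mod_cast (Nat.div_add_mod k 2).symm
  have el : (l : ℝ) = 2 * (l / 2 : ℕ) + (l % 2 : ℕ) := by exact_mod_cast (Nat.div_add_mod l 2).symm
  have hc : ((k % 2 : ℕ) : ℝ) ≤ 1 := by exact_mod_cast (show k % 2 ≤ 1 by omega)
  have hd : ((l % 2 : ℕ) : ℝ) ≤ 1 := by exact_mod_cast (show l % 2 ≤ 1 by omega)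
  have hc0 : (0 : ℝ) ≤ ((k % 2 : ℕ) : ℝ) := by positivity
  have hd0 : (0 : ℝ) ≤ ((l % 2 : ℕ) : ℝ) := by positivity
  rcases hS with rfl | rfl
  · rcases le_or_gt (l % 2) (k % 2) with h | h
    · refine ⟨_, lowerVerts_mem_mesh hk' hl', fun p hp => ?_⟩
      obtain ⟨h1, h2, h3⟩ := (mem_lower_iff hM k l p).1 hp
      rw [gridX_two_mul] at h2 h3
      rw [gridY_two_mul] at h1 h2
      have h' : ((l % 2 : ℕ) : ℝ) ≤ (k % 2 : ℕ) := by exact_mod_cast h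
      exact (mem_lower_iff hN _ _ p).2 ⟨by linarith, by linarith, by linarith⟩
    · refine ⟨_, upperVerts_mem_mesh hk' hl', fun p hp => ?_⟩
      obtain ⟨h1, h2, h3⟩ := (mem_lower_iff hM k l p).1 hp
      rw [gridX_two_mul] at h2 h3
      rw [gridY_two_mul] at h1 h2
      have h' : ((k % 2 : ℕ) : ℝ) + 1 ≤ (l % 2 : ℕ) := by exact_mod_cast h
      exact (mem_upper_iff hN _ _ p).2 ⟨by linarith, by linarith, by linarith⟩
  · rcases le_or_gt (k % 2) (l % 2) with h | h
    · refine ⟨_, upperVerts_mem_mesh hk' hl', fun p hp => ?_⟩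
      obtain ⟨h1, h2, h3⟩ := (mem_upper_iff hM k l p).1 hp
      rw [gridX_two_mul] at h1 h2
      rw [gridY_two_mul] at h2 h3
      have h' : ((k % 2 : ℕ) : ℝ) ≤ (l % 2 : ℕ) := by exact_mod_cast h
      exact (mem_upper_iff hN _ _ p).2 ⟨by linarith, by linarith, by linarith⟩
    · refine ⟨_, lowerVerts_mem_mesh hk' hl', fun p hp => ?_⟩
      obtain ⟨h1, h2, h3⟩ := (mem_upper_iff hM k l p).1 hp
      rw [gridX_two_mul] at h1 h2
      rw [gridY_two_mul] at h2 h3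
      have h' : ((l % 2 : ℕ) : ℝ) + 1 ≤ (k % 2 : ℕ) := by exact_mod_cast h
      exact (mem_lower_iff hN _ _ p).2 ⟨by linarith, by linarith, by linarith⟩

lemma femSpace_le_two_mul (hN : 1 ≤ N) : femSpace ω N ≤ femSpace ω (2 * N) := by
  rintro u ⟨hu, hu0, hu1⟩
  refine ⟨hu, hu0, fun S hS => ?_⟩
  obtain ⟨T, hT, hST⟩ := exists_coarse_triangle hN hS
  obtain ⟨a, b, c, h⟩ := hu1 T hT
  exact ⟨a, b, c, fun p hp => h p (hST hp)⟩

lemma femSpace_midpoint {u : ℝ × ℝ → ℝ} (hu : u ∈ femSpace ω N) {S : Set (ℝ × ℝ)}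
    (hS : S ∈ mesh ω N) {x y p : ℝ × ℝ} (hx : x ∈ S) (hy : y ∈ S)
    (hp : p = (1 / 2 : ℝ) • x + (1 / 2 : ℝ) • y) : u p = (u x + u y) / 2 := by
  obtain ⟨a, b, c, h⟩ := hu.2.2 S hS
  have hx' := subset_convexHull ℝ S hx
  have hy' := subset_convexHull ℝ S hy
  have hp' : p ∈ convexHull ℝ S := hp ▸
    convex_convexHull ℝ S hx' hy' (by norm_num) (by norm_num) (by norm_num)
  rw [h p hp', h x hx', h y hy', hp]
  simp only [Prod.fst_add, Prod.snd_add, Prod.smul_fst, Prod.smul_snd, smul_eq_mul]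
  ring

lemma node_two_mul (i j : ℕ) : node ω (2 * N) (2 * i) (2 * j) = node ω N i j := by
  have : ∀ i : ℕ, 2 * ((2 * i : ℕ) : ℝ) / (2 * N : ℕ) = 2 * i / N := by
    intro i
    push_cast
    rw [show (2 : ℝ) * (2 * i) = 2 * (2 * i) by ring, mul_div_mul_left _ _ (two_ne_zero)]
  rw [node, node, this, this]

lemma node_midpoint {i j i' j' k l : ℕ} (hk : 2 * k = i + i') (hl : 2 * l = j + j') :
    node ω M k l = (1 / 2 : ℝ) • node ω M i j + (1 / 2 : ℝ) • node ω M i' j' := by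
  have hk' : 2 * (k : ℝ) = i + i' := by exact_mod_cast hk
  have hl' : 2 * (l : ℝ) = j + j' := by exact_mod_cast hl
  ext
  · simp only [node, rotate, Prod.fst_add, Prod.smul_fst, smul_eq_mul]
    rw [hk', hl']
    ring
  · simp only [node, rotate, Prod.snd_add, Prod.smul_snd, smul_eq_mul]
    rw [hk', hl']
    ring

/-- The grid function `g` seen from the coarse square `(k, l)`. -/
def shift (g : ℕ → ℕ → ℝ) (k l a b : ℕ) : ℝ := g (2 * k + a) (2 * l + b)

/-- The difference of `v` and a coarse function with the same values at the coarse nodes is an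
interpolation error on each coarse square. -/
lemma isInterpolationError_shift {v vH : ℝ × ℝ → ℝ} (hvH : vH ∈ femSpace ω N)
    (h : ∀ i ≤ N, ∀ j ≤ N, vH (node ω N i j) = v (node ω N i j)) {k l : ℕ} (hk : k < N)
    (hl : l < N) :
    IsInterpolationError (shift (nodal ω (2 * N) v) k l)
      (shift (fun i j => nodal ω (2 * N) v i j - nodal ω (2 * N) vH i j) k l) := by
  have hlow := lowerVerts_mem_mesh (ω := ω) hk hl
  have hup := upperVerts_mem_mesh (ω := ω) hk hl
  have c00 : node ω (2 * N) (2 * k + 0) (2 * l + 0) = node ω N k l := node_two_mul k l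
  have c20 : node ω (2 * N) (2 * k + 2) (2 * l + 0) = node ω N (k + 1) l := node_two_mul (k + 1) l
  have c02 : node ω (2 * N) (2 * k + 0) (2 * l + 2) = node ω N k (l + 1) := node_two_mul k (l + 1)
  have c22 : node ω (2 * N) (2 * k + 2) (2 * l + 2) = node ω N (k + 1) (l + 1) :=
    node_two_mul (k + 1) (l + 1)
  have l00 : node ω N k l ∈ lowerVerts ω N k l := by simp [lowerVerts]
  have l10 : node ω N (k + 1) l ∈ lowerVerts ω N k l := by simp [lowerVerts]
  have l11 : node ω N (k + 1) (l + 1) ∈ lowerVerts ω N k l := by simp [lowerVerts]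
  have u00 : node ω N k l ∈ upperVerts ω N k l := by simp [upperVerts]
  have u01 : node ω N k (l + 1) ∈ upperVerts ω N k l := by simp [upperVerts]
  have u11 : node ω N (k + 1) (l + 1) ∈ upperVerts ω N k l := by simp [upperVerts]
  have v00 := h k hk.le l hl.le
  have v20 := h (k + 1) hk l hl.le
  have v02 := h k hk.le (l + 1) hl
  have v22 := h (k + 1) hk (l + 1) hl
  have m10 := femSpace_midpoint hvH hlow l00 l10 (p := node ω (2 * N) (2 * k + 1) (2 * l + 0))
    (by rw [← c00, ← c20]; exact node_midpoint (by ring) (by ring))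
  have m21 := femSpace_midpoint hvH hlow l10 l11 (p := node ω (2 * N) (2 * k + 2) (2 * l + 1))
    (by rw [← c20, ← c22]; exact node_midpoint (by ring) (by ring))
  have m11 := femSpace_midpoint hvH hlow l00 l11 (p := node ω (2 * N) (2 * k + 1) (2 * l + 1))
    (by rw [← c00, ← c22]; exact node_midpoint (by ring) (by ring))
  have m01 := femSpace_midpoint hvH hup u00 u01 (p := node ω (2 * N) (2 * k + 0) (2 * l + 1))
    (by rw [← c00, ← c02]; exact node_midpoint (by ring) (by ring))
  have m12 := femSpace_midpoint hvH hup u01 u11 (p := node ω (2 * N) (2 * k + 1) (2 * l + 2))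
    (by rw [← c02, ← c22]; exact node_midpoint (by ring) (by ring))
  constructor <;> simp only [shift, nodal]
  · rw [c00, v00, sub_self]
  · rw [c20, v20, sub_self]
  · rw [c02, v02, sub_self]
  · rw [c22, v22, sub_self]
  · rw [m10, c00, c20, v00, v20]
  · rw [m01, c00, c02, v00, v02]
  · rw [m21, c20, c22, v20, v22]
  · rw [m12, c02, c22, v02, v22]
  · rw [m11, c00, c22, v00, v22]

lemma node_mem_domain_iff (hM : 1 ≤ M) (i j : ℕ) :
    node ω M i j ∈ domain ω ↔ (0 < i ∧ i < M) ∧ (0 < j ∧ j < M) := by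
  rw [mem_domain_iff hM, gridX_node hM, gridY_node hM]
  norm_cast

/-- The nodal interpolant on the coarse grid. -/
lemma exists_coarse_interpolant (hN : 1 ≤ N) {v : ℝ × ℝ → ℝ} (hv : v ∈ femSpace ω (2 * N)) :
    ∃ vH ∈ femSpace ω N, ∀ i ≤ N, ∀ j ≤ N, vH (node ω N i j) = v (node ω N i j) :=
  exists_interpolant hN (fun i j => v (node ω N i j)) fun i j hij =>
    hv.2.1 _ fun hmem => hij ((node_mem_domain_iff hN i j).1 hmem)

lemma sum_range_two_mul (f : ℕ → ℝ) (n : ℕ) :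
    ∑ i ∈ Finset.range (2 * n), f i = ∑ k ∈ Finset.range n, (f (2 * k) + f (2 * k + 1)) := by
  induction n with
  | zero => simp
  | succ n ih =>
    rw [show 2 * (n + 1) = 2 * n + 1 + 1 by ring, Finset.sum_range_succ, Finset.sum_range_succ, ih,
      Finset.sum_range_succ]
    ring

/-- The energy as a sum over the coarse squares. -/
lemma sum_cellForm_eq_sum_patch (ε : ℝ) (g : ℕ → ℕ → ℝ) :
    ∑ i ∈ Finset.range (2 * N), ∑ j ∈ Finset.range (2 * N), cellForm ω ε g g i j =
      ∑ k ∈ Finset.range N, ∑ l ∈ Finset.range N,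
        (patchX ω (shift g k l) + ε * patchY ω (shift g k l)) := by
  rw [sum_range_two_mul]
  refine Finset.sum_congr rfl fun k _ => ?_
  rw [sum_range_two_mul, sum_range_two_mul, ← Finset.sum_add_distrib]
  refine Finset.sum_congr rfl fun l _ => ?_
  have hX : ∀ a b, lowX ω (shift g k l) a b = lowX ω g (2 * k + a) (2 * l + b) := fun _ _ => rfl
  have hY : ∀ a b, lowY ω (shift g k l) a b = lowY ω g (2 * k + a) (2 * l + b) := fun _ _ => rfl
  have hX' : ∀ a b, upX ω (shift g k l) a b = upX ω g (2 * k + a) (2 * l + b) := fun _ _ => rfl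
  have hY' : ∀ a b, upY ω (shift g k l) a b = upY ω g (2 * k + a) (2 * l + b) := fun _ _ => rfl
  simp only [patchX, patchY, hX, hY, hX', hY', cellForm, add_zero]
  ring

lemma patchX_congr {g g' : ℕ → ℕ → ℝ} (h : ∀ a ≤ 2, ∀ b ≤ 2, g a b = g' a b) :
    patchX ω g = patchX ω g' := by
  have hl : ∀ a ≤ 1, ∀ b ≤ 1, lowX ω g a b = lowX ω g' a b := fun a ha b hb => by
    rw [lowX, lowX, h a (by omega) b (by omega), h (a + 1) (by omega) b (by omega),
      h (a + 1) (by omega) (b + 1) (by omega)]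
  have hu : ∀ a ≤ 1, ∀ b ≤ 1, upX ω g a b = upX ω g' a b := fun a ha b hb => by
    rw [upX, upX, h a (by omega) b (by omega), h a (by omega) (b + 1) (by omega),
      h (a + 1) (by omega) (b + 1) (by omega)]
  simp [patchX, hl, hu]

lemma patchY_congr {g g' : ℕ → ℕ → ℝ} (h : ∀ a ≤ 2, ∀ b ≤ 2, g a b = g' a b) :
    patchY ω g = patchY ω g' := by
  have hl : ∀ a ≤ 1, ∀ b ≤ 1, lowY ω g a b = lowY ω g' a b := fun a ha b hb => by
    rw [lowY, lowY, h a (by omega) b (by omega), h (a + 1) (by omega) b (by omega),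
      h (a + 1) (by omega) (b + 1) (by omega)]
  have hu : ∀ a ≤ 1, ∀ b ≤ 1, upY ω g a b = upY ω g' a b := fun a ha b hb => by
    rw [upY, upY, h a (by omega) b (by omega), h a (by omega) (b + 1) (by omega),
      h (a + 1) (by omega) (b + 1) (by omega)]
  simp [patchY, hl, hu]

/-! ### Strips -/

lemma node_snd_sub (i j i' j' : ℕ) : (node ω M i j).2 - (node ω M i' j').2 =
    2 / M * (Real.sin ω * ((i : ℝ) - i') + Real.cos ω * ((j : ℝ) - j')) := by
  simp only [node, rotate]
  ring

lemma abs_node_snd_sub_le {d h : ℝ} (hh : 2 / (M : ℝ) ≤ h) {i j i' j' : ℕ}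
    (hi : |(i : ℝ) - i'| ≤ d) (hj : |(j : ℝ) - j'| ≤ d) :
    |(node ω M i j).2 - (node ω M i' j').2| ≤ 2 * d * h := by
  have hd : 0 ≤ d := (abs_nonneg _).trans hi
  have hM : (0 : ℝ) ≤ 2 / M := by positivity
  rw [node_snd_sub, abs_mul, abs_of_nonneg hM, mul_comm]
  refine mul_le_mul ((abs_add_le _ _).trans ?_) hh hM (by positivity)
  rw [abs_mul, abs_mul, two_mul]
  refine add_le_add ?_ ?_
  · exact (mul_le_mul (Real.abs_sin_le_one ω) hi (abs_nonneg _) zero_le_one).trans (one_mul d).le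
  · exact (mul_le_mul (Real.abs_cos_le_one ω) hj (abs_nonneg _) zero_le_one).trans (one_mul d).le

lemma abs_natCast_sub_le {i j d : ℕ} (h1 : i ≤ j + d) (h2 : j ≤ i + d) :
    |(i : ℝ) - j| ≤ d := by
  have h1' : (i : ℝ) ≤ j + d := by exact_mod_cast h1
  have h2' : (j : ℝ) ≤ i + d := by exact_mod_cast h2
  exact abs_le.2 ⟨by linarith, by linarith⟩

/-- The finite element functions whose nodal values vanish outside the strip belong to the
block. -/
lemma mem_stripSpace (hM : 1 ≤ M) {u : ℝ × ℝ → ℝ} (hu : u ∈ femSpace ω M) {h : ℝ} {n : ℕ}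
    (hn : ∀ i ≤ M, ∀ j ≤ M, u (node ω M i j) ≠ 0 → node ω M i j ∈ strip ω h n) :
    u ∈ stripSpace ω M h n := by
  refine ⟨hu, closure_mono fun p hp => ?_⟩
  have hpd : p ∈ domain ω := by
    by_contra hpd
    exact hp (hu.2.1 p hpd)
  obtain ⟨S, hS, hpS⟩ := exists_triangle_of_mem_domain hM hpd
  refine mem_biUnion (x := S) ⟨hS, ?_⟩ hpS
  by_contra hcon
  apply hp
  obtain ⟨a, b, c, hS'⟩ := hu.2.2 S hS
  have hzero : ∀ q ∈ S, u q = 0 := by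
    intro q hq
    by_contra hne
    refine hcon ⟨q, hq, ?_⟩
    obtain ⟨i, hi, j, hj, rfl | rfl⟩ := hS <;> obtain rfl | rfl | rfl := hq
    · exact hn _ (by omega) _ (by omega) hne
    · exact hn _ (by omega) _ (by omega) hne
    · exact hn _ (by omega) _ (by omega) hne
    · exact hn _ (by omega) _ (by omega) hne
    · exact hn _ (by omega) _ (by omega) hne
    · exact hn _ (by omega) _ (by omega) hne
  have hconv : Convex ℝ {q : ℝ × ℝ | a * q.1 + b * q.2 + c = 0} := by
    intro x hx y hy s t _ _ hst
    simp only [mem_ofPred_eq, Prod.fst_add, Prod.snd_add, Prod.smul_fst, Prod.smul_snd,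
      smul_eq_mul] at hx hy ⊢
    linear_combination s * hx + t * hy - c * hst
  have := convexHull_min (fun q hq => by
    rw [mem_ofPred_eq, ← hS' q (subset_convexHull ℝ S hq)]
    exact hzero q hq) hconv hpS
  rw [hS' p hpS]
  exact this

/-- The nodes at which a function of the block does not vanish are close to the strip. -/
lemma height_of_stripSpace {h : ℝ} (hh : 2 / (M : ℝ) ≤ h) {n : ℕ}
    {u : ℝ × ℝ → ℝ} (hu : u ∈ stripSpace ω M h n) {p : ℝ × ℝ} (hp : u p ≠ 0) :
    ((n : ℝ) - 3) * h ≤ p.2 - yMin ω ∧ p.2 - yMin ω ≤ ((n : ℝ) + 3) * h := by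
  have hclosed : IsClosed {p : ℝ × ℝ | ((n : ℝ) - 3) * h ≤ p.2 - yMin ω ∧
      p.2 - yMin ω ≤ ((n : ℝ) + 3) * h} :=
    (isClosed_le continuous_const (continuous_snd.sub continuous_const)).inter
      (isClosed_le (continuous_snd.sub continuous_const) continuous_const)
  have hconv : Convex ℝ {p : ℝ × ℝ | ((n : ℝ) - 3) * h ≤ p.2 - yMin ω ∧
      p.2 - yMin ω ≤ ((n : ℝ) + 3) * h} := by
    rintro x ⟨hx1, hx2⟩ y ⟨hy1, hy2⟩ s t hs ht hst
    have ht' : t = 1 - s := by linarith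
    subst ht'
    simp only [mem_ofPred_eq, Prod.snd_add, Prod.smul_snd, smul_eq_mul]
    have h1 := mul_le_mul_of_nonneg_left hx1 hs
    have h2 := mul_le_mul_of_nonneg_left hx2 hs
    have h3 := mul_le_mul_of_nonneg_left hy1 ht
    have h4 := mul_le_mul_of_nonneg_left hy2 ht
    exact ⟨by linarith, by linarith⟩
  refine closure_minimal ?_ hclosed (hu.2 (subset_tsupport u hp))
  refine iUnion₂_subset fun S hS => convexHull_min (fun q hq => ?_) hconv
  obtain ⟨hS, q', hq', h1, h2⟩ := hS
  have hdiff : |q.2 - q'.2| ≤ 2 * 1 * h := by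
    have key : ∀ {i j i' j' : ℕ}, i ≤ i' + 1 → i' ≤ i + 1 → j ≤ j' + 1 → j' ≤ j + 1 →
        |(node ω M i j).2 - (node ω M i' j').2| ≤ 2 * 1 * h := fun h1 h2 h3 h4 =>
      abs_node_snd_sub_le hh (by exact_mod_cast abs_natCast_sub_le h1 h2)
        (by exact_mod_cast abs_natCast_sub_le h3 h4)
    obtain ⟨i, hi, j, hj, rfl | rfl⟩ := hS <;> obtain rfl | rfl | rfl := hq <;>
      obtain rfl | rfl | rfl := hq' <;>
      exact key (by omega) (by omega) (by omega) (by omega)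
  obtain ⟨h3, h4⟩ := abs_le.1 hdiff
  exact ⟨by linarith, by linarith⟩

/-- Blocks of distant strips are orthogonal. -/
lemma energyForm_stripSpace_eq_zero (hM : 1 ≤ M) {h ε : ℝ} (hh : 2 / (M : ℝ) ≤ h) {m n : ℕ}
    (hmn : m + 9 ≤ n) {u u' : ℝ × ℝ → ℝ} (hu : u ∈ stripSpace ω M h m)
    (hu' : u' ∈ stripSpace ω M h n) : energyForm ω ε u u' = 0 := by
  obtain ⟨A, -, hA⟩ := energyForm_eq_sum ω hM
  rw [hA ε u hu.1 u' hu'.1]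
  have hh0 : 0 < h := lt_of_lt_of_le (by positivity) hh
  have hmn' : (m : ℝ) + 9 ≤ n := by exact_mod_cast hmn
  have key : ∀ {i j i' j' : ℕ}, i ≤ i' + 1 → i' ≤ i + 1 → j ≤ j' + 1 → j' ≤ j + 1 →
      nodal ω M u i j ≠ 0 → nodal ω M u' i' j' = 0 := by
    intro i j i' j' h1 h2 h3 h4 hne
    by_contra hne'
    have h5 := (height_of_stripSpace hh hu hne).2
    have h6 := (height_of_stripSpace hh hu' hne').1
    have h7 := (abs_le.1 (abs_node_snd_sub_le (ω := ω) (d := 1) hh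
      (by exact_mod_cast abs_natCast_sub_le h1 h2)
      (by exact_mod_cast abs_natCast_sub_le h3 h4))).1
    nlinarith
  convert mul_zero A
  refine Finset.sum_eq_zero fun i _ => Finset.sum_eq_zero fun j _ => ?_
  by_cases hz : ∃ a ≤ 1, ∃ b ≤ 1, nodal ω M u (i + a) (j + b) ≠ 0
  · obtain ⟨a, ha, b, hb, hne⟩ := hz
    have h00 : nodal ω M u' i j = 0 := key (by omega) (by omega) (by omega) (by omega) hne
    have h10 : nodal ω M u' (i + 1) j = 0 := key (by omega) (by omega) (by omega) (by omega) hne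
    have h01 : nodal ω M u' i (j + 1) = 0 := key (by omega) (by omega) (by omega) (by omega) hne
    have h11 : nodal ω M u' (i + 1) (j + 1) = 0 :=
      key (by omega) (by omega) (by omega) (by omega) hne
    simp [cellForm, lowX, lowY, upX, upY, h00, h10, h01, h11]
  · push Not at hz
    have h00 : nodal ω M u i j = 0 := hz 0 (by omega) 0 (by omega)
    have h10 : nodal ω M u (i + 1) j = 0 := hz 1 (by omega) 0 (by omega)
    have h01 : nodal ω M u i (j + 1) = 0 := hz 0 (by omega) 1 (by omega)
    have h11 : nodal ω M u (i + 1) (j + 1) = 0 := hz 1 (by omega) 1 (by omega)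
    simp [cellForm, lowX, lowY, upX, upY, h00, h10, h01, h11]

lemma abs_snd_le_of_mem_closure {p : ℝ × ℝ} (hp : p ∈ closure (domain ω)) : |p.2| ≤ 2 := by
  refine closure_minimal (t := {p : ℝ × ℝ | |p.2| ≤ 2}) ?_
    (isClosed_le (by fun_prop) (by fun_prop)) hp
  rintro _ ⟨⟨x, y⟩, ⟨⟨hx1, hx2⟩, hy1, hy2⟩, rfl⟩
  simp only [mem_ofPred_eq, rotate] at *
  refine (abs_add_le _ _).trans ?_
  rw [abs_mul, abs_mul]
  have h1 := mul_le_mul (Real.abs_sin_le_one ω) (abs_le.2 ⟨hx1.le, hx2.le⟩) (abs_nonneg _)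
    zero_le_one
  have h2 := mul_le_mul (Real.abs_cos_le_one ω) (abs_le.2 ⟨hy1.le, hy2.le⟩) (abs_nonneg _)
    zero_le_one
  linarith

lemma yMin_le {p : ℝ × ℝ} (hp : p ∈ closure (domain ω)) : yMin ω ≤ p.2 :=
  csInf_le ⟨-2, by rintro _ ⟨q, hq, rfl⟩; exact (abs_le.1 (abs_snd_le_of_mem_closure hq)).1⟩
    (mem_image_of_mem _ hp)

lemma le_yMax {p : ℝ × ℝ} (hp : p ∈ closure (domain ω)) : p.2 ≤ yMax ω :=
  le_csSup ⟨2, by rintro _ ⟨q, hq, rfl⟩; exact (abs_le.1 (abs_snd_le_of_mem_closure hq)).2⟩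
    (mem_image_of_mem _ hp)

lemma rotate_mem_closure_domain {p : ℝ × ℝ} (hp : p ∈ Icc (-1 : ℝ) 1 ×ˢ Icc (-1 : ℝ) 1) :
    rotate ω p ∈ closure (domain ω) := by
  have hcont : Continuous (rotate ω) := by unfold rotate; fun_prop
  refine image_closure_subset_closure_image hcont (mem_image_of_mem _ ?_)
  rwa [closure_prod_eq, closure_Ioo (by norm_num)]

/-- The height of the rotated square is at least `√2`. -/
lemma sqrt_two_le_height : √2 ≤ yMax ω - yMin ω := by
  have key : ∀ {x y : ℝ}, (x, y) ∈ Icc (-1 : ℝ) 1 ×ˢ Icc (-1 : ℝ) 1 →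
      (-x, -y) ∈ Icc (-1 : ℝ) 1 ×ˢ Icc (-1 : ℝ) 1 →
      2 * (Real.sin ω * x + Real.cos ω * y) ≤ yMax ω - yMin ω := by
    intro x y h h'
    have h1 := le_yMax (rotate_mem_closure_domain (ω := ω) h)
    have h2 := yMin_le (rotate_mem_closure_domain (ω := ω) h')
    simp only [rotate] at h1 h2
    linarith
  have h1 := key (x := 1) (y := 0) (by simp) (by simp)
  have h2 := key (x := -1) (y := 0) (by simp) (by simp)
  have h3 := key (x := 0) (y := 1) (by simp) (by simp)
  have h4 := key (x := 0) (y := -1) (by simp) (by simp)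
  have hs := Real.sin_sq_add_cos_sq ω
  rw [Real.sqrt_le_left (by linarith)]
  nlinarith [mul_nonneg (sub_nonneg.2 h1) (show 0 ≤ yMax ω - yMin ω + 2 * Real.sin ω by linarith),
    mul_nonneg (sub_nonneg.2 h3) (show 0 ≤ yMax ω - yMin ω + 2 * Real.cos ω by linarith)]

/-! ### A partition of unity over the strips -/

/-- The ramp that rises from `0` at `k` to `1` at `k + 1`, except that it is constantly `1` for
`k = 0` and constantly `0` for `k ≥ L`. -/
noncomputable def ramp (L k : ℕ) (t : ℝ) : ℝ :=
  if k = 0 then 1 else if L ≤ k then 0 else max 0 (min 1 (t - k))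

/-- The `n`-th function of the partition of unity, a hat function with peak `n + 1`, where the first
and the last one are constant towards the ends.  Heights are measured in units of the strip
width. -/
noncomputable def stripHat (L n : ℕ) (t : ℝ) : ℝ := ramp L n t - ramp L (n + 1) t

lemma ramp_mem (L k : ℕ) (t : ℝ) : 0 ≤ ramp L k t ∧ ramp L k t ≤ 1 := by
  unfold ramp
  split_ifs
  · norm_num
  · norm_num
  · exact ⟨le_max_left _ _, max_le zero_le_one (min_le_left _ _)⟩

lemma abs_stripHat_le_one (L n : ℕ) (t : ℝ) : |stripHat L n t| ≤ 1 := by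
  have h1 := ramp_mem L n t
  have h2 := ramp_mem L (n + 1) t
  exact abs_le.2 ⟨by unfold stripHat; linarith, by unfold stripHat; linarith⟩

lemma abs_ramp_sub_le (L k : ℕ) (t t' : ℝ) : |ramp L k t - ramp L k t'| ≤ |t - t'| := by
  unfold ramp
  split_ifs
  · simp
  · simp
  · refine (abs_max_sub_max_le_max _ _ _ _).trans (max_le (by simp) ?_)
    refine (abs_min_sub_min_le_max _ _ _ _).trans (max_le (by simp) (by simp))

lemma abs_stripHat_sub_le (L n : ℕ) (t t' : ℝ) :
    |stripHat L n t - stripHat L n t'| ≤ 2 * |t - t'| := by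
  have h1 := abs_ramp_sub_le L n t t'
  have h2 := abs_ramp_sub_le L (n + 1) t t'
  calc |stripHat L n t - stripHat L n t'|
      = |(ramp L n t - ramp L n t') - (ramp L (n + 1) t - ramp L (n + 1) t')| := by
        unfold stripHat; congr 1; ring
    _ ≤ _ := (abs_sub _ _).trans (by linarith)

lemma sum_stripHat {L : ℕ} (hL : 1 ≤ L) (t : ℝ) : ∑ n ∈ Finset.range L, stripHat L n t = 1 := by
  unfold stripHat
  rw [Finset.sum_range_sub']
  simp [ramp, show L ≠ 0 by omega]

lemma stripHat_support {L n : ℕ} (hn : n < L) {t : ℝ} (h0 : 0 ≤ t) (ht : t ≤ L + 1)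
    (h : stripHat L n t ≠ 0) : (n : ℝ) ≤ t ∧ t ≤ n + 2 := by
  constructor
  · by_contra! hlt
    apply h
    have hn0 : n ≠ 0 := by
      rintro rfl
      simp only [Nat.cast_zero] at hlt
      linarith
    have h1 : max 0 (min 1 (t - (n : ℝ))) = 0 :=
      max_eq_left ((min_le_right _ _).trans (by linarith))
    have h2 : max 0 (min 1 (t - ((n + 1 : ℕ) : ℝ))) = 0 :=
      max_eq_left ((min_le_right _ _).trans (by push_cast; linarith))
    simp [stripHat, ramp, hn0, h1, h2, -Nat.cast_add, -Nat.cast_one]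
  · by_contra! hlt
    apply h
    have hL : n + 1 < L := by
      by_contra! hL
      obtain rfl : L = n + 1 := by omega
      push_cast at ht
      linarith
    have h1 : max 0 (min 1 (t - (n : ℝ))) = 1 := by
      rw [min_eq_left (by linarith), max_eq_right zero_le_one]
    have h2 : max 0 (min 1 (t - ((n + 1 : ℕ) : ℝ))) = 1 := by
      rw [min_eq_left (by push_cast; linarith), max_eq_right zero_le_one]
    rw [stripHat, ramp, ramp, h1, h2]
    simp [show ¬ L ≤ n by omega, show ¬ L ≤ n + 1 by omega]

/-! ### The stable decomposition -/

/-- The height of a node above the lowest point of the domain, in units of the strip width. -/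
noncomputable def nodeHeight (ω : ℝ) (M : ℕ) (h : ℝ) (i j : ℕ) : ℝ :=
  ((node ω M i j).2 - yMin ω) / h

lemma abs_nodeHeight_sub_le {h : ℝ} (hh0 : 0 < h) (hh : 2 / (M : ℝ) ≤ h) (i j i' j' : ℕ) :
    |nodeHeight ω M h i j - nodeHeight ω M h i' j'| ≤
      |Real.sin ω * ((i : ℝ) - i') + Real.cos ω * ((j : ℝ) - j')| := by
  have e : nodeHeight ω M h i j - nodeHeight ω M h i' j' =
      2 / M / h * (Real.sin ω * ((i : ℝ) - i') + Real.cos ω * ((j : ℝ) - j')) := by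
    rw [nodeHeight, nodeHeight, ← sub_div, sub_sub_sub_cancel_right, node_snd_sub]
    ring
  have h1 : 2 / (M : ℝ) / h ≤ 1 := (div_le_one hh0).2 hh
  rw [e, abs_mul, abs_of_nonneg (by positivity)]
  exact mul_le_of_le_one_left (abs_nonneg _) h1

lemma isCutoff_stripHat {h : ℝ} (hh0 : 0 < h) (hh : 2 / (M : ℝ) ≤ h) (L n k l : ℕ) :
    IsCutoff ω (shift (fun i j => stripHat L n (nodeHeight ω M h i j)) k l) := by
  have key : ∀ i j i' j' : ℕ, |stripHat L n (nodeHeight ω M h i j) -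
      stripHat L n (nodeHeight ω M h i' j')| ≤
        2 * |Real.sin ω * ((i : ℝ) - i') + Real.cos ω * ((j : ℝ) - j')| := fun i j i' j' =>
    (abs_stripHat_sub_le _ _ _ _).trans
      (mul_le_mul_of_nonneg_left (abs_nodeHeight_sub_le hh0 hh i j i' j') zero_le_two)
  refine ⟨fun i j => abs_stripHat_le_one _ _ _, fun i j => (key _ _ _ _).trans_eq ?_,
    fun i j => (key _ _ _ _).trans_eq ?_, fun i j => (key _ _ _ _).trans_eq ?_⟩
  · push_cast; congr 2; ring
  · push_cast; congr 2; ring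
  · push_cast; congr 2; ring

/-- Only boundedly many members of the decomposition are nonzero on a coarse square, so the local
estimates can be summed. -/
lemma sum_patch_stripHat_le {h : ℝ} (hh0 : 0 < h) (hh : 2 / (M : ℝ) ≤ h) {L : ℕ}
    {v w : ℕ → ℕ → ℝ} {k l : ℕ} (hvw : IsInterpolationError (shift v k l) (shift w k l))
    (hw : ∀ i j, w i j ≠ 0 → 0 ≤ nodeHeight ω M h i j ∧ nodeHeight ω M h i j ≤ L + 1)
    {ε ε₀ : ℝ} (hε : 0 ≤ ε) (hε₀ : ε ≤ ε₀) {z : ℕ → ℕ → ℕ → ℝ}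
    (hz : ∀ n < L, ∀ a ≤ 2, ∀ b ≤ 2, shift (z n) k l a b =
      stripHat L n (nodeHeight ω M h (2 * k + a) (2 * l + b)) * w (2 * k + a) (2 * l + b)) :
    ∑ n ∈ Finset.range L, (patchX ω (shift (z n) k l) + ε * patchY ω (shift (z n) k l)) ≤
      13 * (2394 + 318 * ε₀) * (patchX ω (shift v k l) + ε * patchY ω (shift v k l)) := by
  have hBnn : 0 ≤ (2394 + 318 * ε₀) * (patchX ω (shift v k l) + ε * patchY ω (shift v k l)) := by
    have h0 : 0 ≤ ε₀ := hε.trans hε₀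
    have := patchX_nonneg ω (shift v k l)
    have := patchY_nonneg ω (shift v k l)
    positivity
  have hle : ∀ n ∈ Finset.range L, patchX ω (shift (z n) k l) + ε * patchY ω (shift (z n) k l) ≤
      (2394 + 318 * ε₀) * (patchX ω (shift v k l) + ε * patchY ω (shift v k l)) := by
    intro n hn
    have hn' := Finset.mem_range.1 hn
    have := (isCutoff_stripHat (ω := ω) hh0 hh L n k l).patch_le hvw hε hε₀
    rwa [patchX_congr (hz n hn'), patchY_congr (hz n hn')]
  by_cases hact : ∃ n₀ < L, ∃ a ≤ 2, ∃ b ≤ 2, shift (z n₀) k l a b ≠ 0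
  · obtain ⟨n₀, hn₀, a, ha, b, hb, hne⟩ := hact
    have near : ∀ {n a b}, n < L → a ≤ 2 → b ≤ 2 → shift (z n) k l a b ≠ 0 →
        (n : ℝ) ≤ nodeHeight ω M h (2 * k + a) (2 * l + b) ∧
          nodeHeight ω M h (2 * k + a) (2 * l + b) ≤ n + 2 := by
      intro n a b hn ha hb hne
      rw [hz n hn a ha b hb] at hne
      obtain ⟨h1, h2⟩ := hw _ _ (right_ne_zero_of_mul hne)
      exact stripHat_support hn h1 h2 (left_ne_zero_of_mul hne)
    obtain ⟨h1, h2⟩ := near hn₀ ha hb hne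
    have hzero : ∀ n ∈ Finset.range L, n ∉ Finset.Icc (n₀ - 6) (n₀ + 6) →
        patchX ω (shift (z n) k l) + ε * patchY ω (shift (z n) k l) = 0 := by
      intro n hn hn'
      have hvan : ∀ a' ≤ 2, ∀ b' ≤ 2, shift (z n) k l a' b' = (fun _ _ => 0 : ℕ → ℕ → ℝ) a' b' := by
        intro a' ha' b' hb'
        by_contra hne'
        obtain ⟨h3, h4⟩ := near (Finset.mem_range.1 hn) ha' hb' hne'
        -- two nodes of a coarse square differ in height by at most four grid sizes
        have h5 : |nodeHeight ω M h (2 * k + a) (2 * l + b) -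
            nodeHeight ω M h (2 * k + a') (2 * l + b')| ≤ 4 := by
          refine (abs_nodeHeight_sub_le hh0 hh _ _ _ _).trans ((abs_add_le _ _).trans ?_)
          rw [abs_mul, abs_mul]
          have h6 := mul_le_mul (Real.abs_sin_le_one ω)
            (abs_natCast_sub_le (i := 2 * k + a) (j := 2 * k + a') (d := 2) (by omega) (by omega))
            (abs_nonneg _) zero_le_one
          have h7 := mul_le_mul (Real.abs_cos_le_one ω)
            (abs_natCast_sub_le (i := 2 * l + b) (j := 2 * l + b') (d := 2) (by omega) (by omega))
            (abs_nonneg _) zero_le_one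
          push_cast at h6 h7 ⊢
          linarith
        obtain ⟨h6, h7⟩ := abs_le.1 h5
        have h8 : (n : ℝ) ≤ n₀ + 6 := by linarith
        have h9 : (n₀ : ℝ) ≤ n + 6 := by linarith
        have h8' : n ≤ n₀ + 6 := by exact_mod_cast h8
        have h9' : n₀ ≤ n + 6 := by exact_mod_cast h9
        exact hn' (Finset.mem_Icc.2 ⟨by omega, h8'⟩)
      rw [patchX_congr hvan, patchY_congr hvan]
      simp [patchX, patchY, lowX, lowY, upX, upY]
    calc _ = ∑ n ∈ (Finset.range L).filter (· ∈ Finset.Icc (n₀ - 6) (n₀ + 6)),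
          (patchX ω (shift (z n) k l) + ε * patchY ω (shift (z n) k l)) := by
          rw [Finset.sum_filter]
          refine Finset.sum_congr rfl fun n hn => ?_
          split_ifs with h
          · rfl
          · exact hzero n hn h
      _ ≤ ((Finset.range L).filter (· ∈ Finset.Icc (n₀ - 6) (n₀ + 6))).card •
          ((2394 + 318 * ε₀) * (patchX ω (shift v k l) + ε * patchY ω (shift v k l))) :=
          Finset.sum_le_card_nsmul _ _ _ fun n hn => hle n (Finset.mem_of_mem_filter n hn)
      _ ≤ 13 • ((2394 + 318 * ε₀) * (patchX ω (shift v k l) + ε * patchY ω (shift v k l))) := by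
          refine nsmul_le_nsmul_left hBnn ?_
          calc _ ≤ (Finset.Icc (n₀ - 6) (n₀ + 6)).card :=
                Finset.card_le_card fun n hn => (Finset.mem_filter.1 hn).2
            _ ≤ 13 := by rw [Nat.card_Icc]; omega
      _ = _ := by rw [nsmul_eq_mul]; push_cast; ring
  · push Not at hact
    rw [Finset.sum_eq_zero]
    · linarith
    intro n hn
    have hvan : ∀ a' ≤ 2, ∀ b' ≤ 2, shift (z n) k l a' b' = (fun _ _ => 0 : ℕ → ℕ → ℝ) a' b' :=
      hact n (Finset.mem_range.1 hn)
    rw [patchX_congr hvan, patchY_congr hvan]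
    simp [patchX, patchY, lowX, lowY, upX, upY]

/-- Every fine function is the sum of its coarse interpolant and of functions of the blocks whose
energies add up to at most a fixed multiple of its own energy. -/
theorem exists_stable_decomposition (hN : 1 ≤ N) {h : ℝ} (hh : 2 / ((2 * N : ℕ) : ℝ) ≤ h)
    (hh' : h ≤ √2) {ε ε₀ : ℝ} (hε : 0 ≤ ε) (hε₀ : ε ≤ ε₀) {v : ℝ × ℝ → ℝ}
    (hv : v ∈ femSpace ω (2 * N)) :
    ∃ vH ∈ femSpace ω N, ∃ z : ℕ → ℝ × ℝ → ℝ,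
      (∀ n < numStrips ω h, z n ∈ stripSpace ω (2 * N) h (n + 1)) ∧
      (∀ i ≤ 2 * N, ∀ j ≤ 2 * N, nodal ω (2 * N) v i j =
        nodal ω (2 * N) (vH + ∑ n ∈ Finset.range (numStrips ω h), z n) i j) ∧
      ∑ n ∈ Finset.range (numStrips ω h), energyForm ω ε (z n) (z n) ≤
        13 * (2394 + 318 * ε₀) * energyForm ω ε v v := by
  have hM : 1 ≤ 2 * N := by omega
  have hh0 : 0 < h := lt_of_lt_of_le (by positivity) hh
  set L := numStrips ω h with hL
  have hL1 : 1 ≤ L := by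
    rw [hL, numStrips, Nat.one_le_floor_iff, one_le_div hh0]
    exact hh'.trans sqrt_two_le_height
  obtain ⟨vH, hvH, hvHn⟩ := exists_coarse_interpolant hN hv
  have hvH' : vH ∈ femSpace ω (2 * N) := femSpace_le_two_mul hN hvH
  set w : ℕ → ℕ → ℝ := fun i j => nodal ω (2 * N) v i j - nodal ω (2 * N) vH i j with hw
  have hwdom : ∀ i j, w i j ≠ 0 → node ω (2 * N) i j ∈ domain ω := by
    intro i j hne
    by_contra hmem
    apply hne
    simp only [hw, nodal]
    rw [hv.2.1 _ hmem, hvH'.2.1 _ hmem, sub_self]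
  have hheight : ∀ i j, w i j ≠ 0 → 0 ≤ nodeHeight ω (2 * N) h i j ∧
      nodeHeight ω (2 * N) h i j ≤ L + 1 := by
    intro i j hne
    have hmem := subset_closure (hwdom i j hne)
    constructor
    · exact div_nonneg (by linarith [yMin_le hmem]) hh0.le
    · refine (div_le_div_of_nonneg_right (sub_le_sub_right (le_yMax hmem) _) hh0.le).trans ?_
      exact (Nat.lt_floor_add_one _).le
  have hex : ∀ n, ∃ u ∈ femSpace ω (2 * N), ∀ i ≤ 2 * N, ∀ j ≤ 2 * N, u (node ω (2 * N) i j) =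
      stripHat L n (nodeHeight ω (2 * N) h i j) * w i j := fun n =>
    exists_interpolant hM _ fun i j hij => by
      rw [show w i j = 0 by
        by_contra hne
        exact hij ((node_mem_domain_iff hM i j).1 (hwdom i j hne)), mul_zero]
  choose z hz hzn using hex
  refine ⟨vH, hvH, z, fun n hn => ?_, fun i hi j hj => ?_, ?_⟩
  · refine mem_stripSpace hM (hz n) fun i hi j hj hne => ?_
    rw [hzn n i hi j hj] at hne
    obtain ⟨h1, h2⟩ := hheight i j (right_ne_zero_of_mul hne)
    obtain ⟨h3, h4⟩ := stripHat_support hn h1 h2 (left_ne_zero_of_mul hne)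
    rw [nodeHeight, le_div_iff₀ hh0] at h3
    rw [nodeHeight, div_le_iff₀ hh0] at h4
    constructor
    · push_cast; linarith
    · push_cast; linarith
  · have h1 : ∑ n ∈ Finset.range L, z n (node ω (2 * N) i j) = w i j := by
      rw [Finset.sum_congr rfl fun n _ => hzn n i hi j hj, ← Finset.sum_mul, sum_stripHat hL1,
        one_mul]
    simp only [nodal, Pi.add_apply, Finset.sum_apply]
    rw [h1]
    simp only [hw, nodal]
    ring
  · obtain ⟨A, hA, hAeq⟩ := energyForm_eq_sum ω hM
    rw [hAeq ε v hv v hv, Finset.sum_congr rfl fun n _ => hAeq ε (z n) (hz n) (z n) (hz n),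
      ← Finset.mul_sum, mul_left_comm]
    refine mul_le_mul_of_nonneg_left ?_ hA
    simp only [sum_cellForm_eq_sum_patch]
    rw [Finset.sum_comm, Finset.mul_sum]
    refine Finset.sum_le_sum fun k hk => ?_
    rw [Finset.sum_comm, Finset.mul_sum]
    refine Finset.sum_le_sum fun l hl => ?_
    rw [Finset.mem_range] at hk hl
    exact sum_patch_stripHat_le hh0 hh (isInterpolationError_shift hvH hvHn hk hl) hheight hε hε₀
      fun n _ a ha b hb => hzn n _ (by omega) _ (by omega)

/-! ### Convergence of the two-level method -/

lemma stripSpace_le_femSpace (h : ℝ) (n : ℕ) : stripSpace ω M h n ≤ femSpace ω M :=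
  fun _ hu => hu.1

lemma blockSweep_mem {ε h : ℝ} (hε : 0 ≤ ε) (hM : 1 ≤ M) {v : ℝ × ℝ → ℝ}
    (hv : v ∈ femSpace ω M) (n : ℕ) : blockSweep ω ε M h n v ∈ femSpace ω M := by
  induction n with
  | zero => exact hv
  | succ n ih =>
    exact sub_mem ih (stripSpace_le_femSpace h (n + 1)
      (energyProj_spec hε hM (stripSpace_le_femSpace h (n + 1)) ih).1)

theorem energyNorm_twoLevelError_le (hN : 1 ≤ N) {h : ℝ} (hh : 2 / ((2 * N : ℕ) : ℝ) ≤ h)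
    (hh' : h ≤ √2) {ε ε₀ : ℝ} (hε : 0 ≤ ε) (hε₀ : ε ≤ ε₀) {v : ℝ × ℝ → ℝ}
    (hv : v ∈ femSpace ω (2 * N)) :
    energyNorm ω ε (twoLevelError ω ε N h v) ≤
      √(1 - 1 / (108 * (13 * (2394 + 318 * ε₀)))) * energyNorm ω ε v := by
  have hM : 1 ≤ 2 * N := by omega
  obtain ⟨G, hG, hGn⟩ := exists_gradientMap ω hε hM
  have hNM : femSpace ω N ≤ femSpace ω (2 * N) := femSpace_le_two_mul hN
  obtain ⟨hP, hP'⟩ := energyProj_spec hε hM hNM hv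
  set PH := energyProj ω ε (femSpace ω N) v with hPH
  have hx₀ : v - PH ∈ femSpace ω (2 * N) := sub_mem hv (hNM hP)
  have hx := blockSweep_mem (h := h) hε hM hx₀
  obtain ⟨vH, hvH, z, hz, hsum, hstab⟩ := exists_stable_decomposition hN hh hh' hε hε₀ hv
  have hnorm : ∀ u ∈ femSpace ω (2 * N), energyForm ω ε u u = ‖G u‖ ^ 2 := fun u hu => by
    rw [hG u hu u hu, real_inner_self_eq_norm_sq]
  have hcontr := sweep_contraction (C := 13 * (2394 + 318 * ε₀)) (by linarith)
    (fun n => (stripSpace ω (2 * N) h (n + 1)).map G) (numStrips ω h) ?_ (G v)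
    (fun n => G (blockSweep ω ε (2 * N) h n (v - PH))) ?_ ?_ (G vH) ?_ (fun n => G (z n)) ?_ ?_ ?_
  · have h1 : energyNorm ω ε (twoLevelError ω ε N h v) ^ 2 ≤
        (1 - 1 / (108 * (13 * (2394 + 318 * ε₀)))) * energyNorm ω ε v ^ 2 := by
      rw [energyNorm, energyNorm, hnorm _ hv, twoLevelError, ← hPH, hnorm _ (hx _),
        Real.sq_sqrt (by positivity), Real.sq_sqrt (by positivity)]
      exact hcontr
    have hnn : ∀ u, 0 ≤ energyNorm ω ε u := fun u => Real.sqrt_nonneg _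
    have h2 := Real.sqrt_le_sqrt h1
    rwa [Real.sqrt_sq (hnn _), Real.sqrt_mul' _ (sq_nonneg _), Real.sqrt_sq (hnn _)] at h2
  · rintro m n hmn _ ⟨u, hu, rfl⟩ _ ⟨u', hu', rfl⟩
    rw [← hG u hu.1 u' hu'.1]
    exact energyForm_stripSpace_eq_zero hM hh (by omega) hu hu'
  · simp only [blockSweep]
    rw [← map_sub, sub_sub_cancel, ← hG _ hx₀ _ (hNM hP)]
    exact hP' _ hP
  · intro n _
    obtain ⟨h1, h2⟩ := energyProj_spec hε hM (stripSpace_le_femSpace h (n + 1)) (hx n)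
    constructor
    · rw [← map_sub, blockSweep, sub_sub_cancel]
      exact Submodule.mem_map_of_mem h1
    · rintro _ ⟨u, hu, rfl⟩
      rw [← hG _ (hx (n + 1)) u hu.1]
      exact h2 u hu
  · simp only [blockSweep]
    rw [← hG _ hx₀ _ (hNM hvH)]
    exact hP' _ hvH
  · exact fun n hn => Submodule.mem_map_of_mem (hz n hn)
  · rw [← map_sum, ← map_add]
    exact hGn _ _ hsum
  · rw [← hnorm v hv]
    refine le_trans (le_of_eq ?_) hstab
    exact Finset.sum_congr rfl fun n hn => (hnorm _ (hz n (Finset.mem_range.1 hn)).1).symm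

end

end AnisoFEM

theorem mainTheorem1 (ε₀ : ℝ) (hε₀ : 0 < ε₀) :
    ∃ C : ℝ, 1 ≤ C ∧
      ∀ ω ∈ Set.Icc (0 : ℝ) Real.pi, ∀ ε : ℝ, 0 < ε → ε ≤ ε₀ →
        ∀ N : ℕ, 1 ≤ N →
          ∀ h : ℝ, (h = 1 / (N : ℝ) ∨ h = Real.sqrt 2 / (N : ℝ)) →
            AnisoFEM.energyOpNorm ω ε (AnisoFEM.femSpace ω (2 * N))
                (AnisoFEM.twoLevelError ω ε N h) ^ 2
              ≤ ENNReal.ofReal (1 - 1 / C) := by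
  refine ⟨108 * (13 * (2394 + 318 * ε₀)), by linarith, fun ω _ ε hε hεε₀ N hN h hh => ?_⟩
  have hN' : (1 : ℝ) ≤ N := by exact_mod_cast hN
  have hs : 1 ≤ √(2 : ℝ) := Real.one_le_sqrt.2 (by norm_num)
  have hside : 2 / ((2 * N : ℕ) : ℝ) = 1 / N := by
    push_cast
    rw [div_mul_cancel_left₀ two_ne_zero, one_div]
  have h1 : 2 / ((2 * N : ℕ) : ℝ) ≤ h := by
    rw [hside]
    rcases hh with rfl | rfl
    · exact le_rfl
    · gcongr
  have h2 : h ≤ √2 := by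
    rcases hh with rfl | rfl
    · exact (div_le_one (by linarith) |>.2 hN').trans hs
    · exact div_le_self (by linarith) hN'
  have hle : AnisoFEM.energyOpNorm ω ε (AnisoFEM.femSpace ω (2 * N))
      (AnisoFEM.twoLevelError ω ε N h) ≤
        ENNReal.ofReal √(1 - 1 / (108 * (13 * (2394 + 318 * ε₀)))) := by
    refine iSup₂_le fun v hv => ENNReal.div_le_of_le_mul ?_
    rw [← ENNReal.ofReal_mul (Real.sqrt_nonneg _)]
    exact ENNReal.ofReal_le_ofReal
      (AnisoFEM.energyNorm_twoLevelError_le hN h1 h2 hε.le hεε₀ hv)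
  refine (pow_le_pow_left' hle 2).trans_eq ?_
  rw [← ENNReal.ofReal_pow (Real.sqrt_nonneg _), Real.sq_sqrt]
  rw [sub_nonneg, div_le_one (by positivity)]
  linarith
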